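/- Let $S\in\mathbb R$, $\sigma>0$, $\tau>0$. On a probability space let $(p^\star_t)_{t\ge0}$ be a Brownian motion with volatility $\sigma$ and arbitrary initial value (i.e. $(p^\star_t-p^\star_0)/\sigma$ is a standard Brownian motion), let $X_t$, $t\ge 0$, be Bernoulli variables with $\mathbb P(X_t=1)=\mathbb P(X_t=0)=\tfrac12$, and put $\eta_t=S(X_t-\tfrac12)$. Assume that the variables $(\eta_t)_{t\ge0}$ are mutually independent and that the processes $p^\star$ and $\eta$ are independent of each other. The log-price is $p_t=p^\star_t+\eta_t$, observed at the times $0,\tau,\dots,(n-1)\tau$. For an integer $L\ge1$ put $k_1(n,L)=n-L$, $k_2(n,L)=\lfloor (n-1)/L\rfloor$, $k_3(n,L)=\lfloor n/(L+1)\rfloor$ and $$\widehat V_1(n,L)=\frac1{k_1(n,L)}\sum_{i=0}^{k_1(n,L)-1}\bigl(p_{(i+L)\tau}-p_{i\tau}\bigr)^2,\qquad \widehat V_2(n,L)=\frac1{k_2(n,L)}\sum_{i=0}^{k_2(n,L)-1}\bigl(p_{(i+1)L\tau}-p_{iL\tau}\bigr)^2,$$ $$\widehat V_3(n,L)=\frac1{k_3(n,L)}\sum_{i=0}^{k_3(n,L)-1}\bigl(p_{(i+(i+1)L)\tau}-p_{(i+iL)\tau}\bigr)^2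 .$$ For $v\in\{1,2,3\}$ and fixed integers $L,L'\ge1$ with $L\ne L'$, consider the estimator $$\widehat{S^2_{1,v}}(n,L,L')=\frac{2}{L'-L}\bigl(L'\,\widehat V_v(n,L)-L\,\widehat V_v(n,L')\bigr).$$ Let $(\zeta_1(L),\zeta_2(L),\zeta_3(L))=(1,L,L+1)$ and $$\sigma_{1,1}^2(L)=\tfrac23\sigma^4L(1+2L^2)\tau^2+2\sigma^2L\tau S^2+\tfrac{S^4}4,\qquad \sigma_{1,2}^2(L)=\sigma_{1,3}^2(L)=2\sigma^4L^2\tau^2+2\sigma^2L\tau S^2+\tfrac{S^4}4 ,$$ with $\sigma_{1,v}(L)\ge 0$ the square root of $\sigma_{1,v}^2(L)$. Then: 1. $\widehat{S^2_{1,v}}(n,L,L')$ is an unbiased estimator of $S^2$: for every $n>\max(L,L')$ it is integrable with expectation $S^2$. 2. It is consistent: $\widehat{S^2_{1,v}}(n,L,L')\to S^2$ in probability as $n\to\infty$. When $v=3$, the convergence holds almost surely. 3. The limit $r_{1,v}(L,L')=\lim_{n\to\infty}\operatorname{corr}\bigl(\widehat V_v(n,L),\widehat V_v(n,L')\bigr)$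 exists, and $$\sqrt n\,\bigl(\widehat{S^2_{1,v}}(n,L,L')-S^2\bigr)\overset{d}{\longrightarrow}\mathcal N\bigl(0,\gamma_{1,v}(L,L')\bigr)\quad(n\to\infty),$$ where the variance $$\gamma_{1,v}(L,L')=\frac4{(L'-L)^2}\Bigl(L'^2\zeta_v(L)\sigma^2_{1,v}(L)+L^2\zeta_v(L')\sigma^2_{1,v}(L')-2LL'\sqrt{\zeta_v(L)\zeta_v(L')}\,\sigma_{1,v}(L)\sigma_{1,v}(L')\,r_{1,v}(L,L')\Bigr)$$ is non-negative ($\mathcal N(0,0)$ denoting the Dirac mass at $0$). 4. If $L'=m(L+1)-1$ for an integer $m\ge2$, then $\gamma_{1,3}(L,L')=\Gamma(L,L')$, where, with $V(u)=\operatorname{Var}(p_u-p_0)$ and $K(u,\delta)=\mathbb E\bigl[(p_u-p_0)^2(p_{2u-\delta}-p_{u-\delta})^2\bigr]$, $$\begin{aligned}\Gamma(L,L')=\frac{4(L'+1)}{(L'-L)^2}\Bigl\{&L'\Bigl(\frac{L'(L+1)}{L'+1}-2L\Bigr)\bigl(K(L\tau,L\tau)-V(L\tau)^2\bigr)+L^2\bigl(K(L'\tau,L'\tau)-V(L'\tau)^2\bigr)\\&-2L'L\Bigl(-2\frac{L'-L}{L'+1}S^2V(L\tau)+\frac{3L'-4L-1}{L'+1}\frac{S^4}4\Bigr)\Bigr\}.\end{aligned}$$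 -/

import Mathlib

open MeasureTheory ProbabilityTheory Filter Topology
open scoped NNReal

namespace BidAskSpread

noncomputable section

/-- The process `W` is a real Brownian motion with volatility `σ` and an arbitrary (possibly random)
initial value: `(W t - W 0) / σ` is a standard Brownian motion. -/
structure IsBrownianWithVolatility {Ω : Type*} [MeasurableSpace Ω]
    (W : ℝ≥0 → Ω → ℝ) (σ : ℝ) (μ : Measure Ω) : Prop where
  aemeasurable_zero : AEMeasurable (W 0) μ
  isBrownianReal : IsBrownianReal (fun t ω => (W t ω - W 0 ω) / σ) μ

/-- The Bernoulli distribution `B(1/2)` on `{0, 1} ⊆ ℝ`. -/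
def bernoulliHalf : Measure ℝ :=
  bernoulliMeasure (1 : ℝ) 0 ⟨1 / 2, by norm_num, by norm_num⟩

/-- The microstructure noise `η_t = S (X_t - 1/2)`. -/
def noise {Ω : Type*} (S : ℝ) (X : ℝ≥0 → Ω → ℝ) (t : ℝ≥0) (ω : Ω) : ℝ :=
  S * (X t ω - 1 / 2)

/-- The observed log-price `p_t = p⋆_t + η_t`. -/
def logPrice {Ω : Type*} (S : ℝ) (pStar X : ℝ≥0 → Ω → ℝ) (t : ℝ≥0) (ω : Ω) : ℝ :=
  pStar t ω + noise S X t ω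

/-- The assumptions of the zero-autocorrelation market model. -/
structure MarketModel {Ω : Type*} [MeasurableSpace Ω] (μ : Measure Ω)
    (pStar X : ℝ≥0 → Ω → ℝ) (σ S : ℝ) : Prop where
  /-- the logarithmic mid price is a Brownian motion with volatility `σ` -/
  brownian : IsBrownianWithVolatility pStar σ μ
  /-- the trade directions are Bernoulli variables of parameter `1/2` -/
  direction_law : ∀ t, HasLaw (X t) bernoulliHalf μ
  /-- the noise variables at distinct times are (mutually) independent -/
  noise_indep : iIndepFun (noise S X) μ
  /-- the processes `p⋆` and `η` are independent of each other -/
  mid_indep_noise : IndepFun (fun ω t => pStar t ω) (fun ω t => noise S X t ω) μ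

/-- The three ways of selecting price increments: overlapping (`v = 1`), non-overlapping (`v = 2`)
and strictly disjoint (`v = 3`). -/
inductive Scheme where
  | overlapping
  | nonOverlapping
  | disjoint

/-- The number `k_v(n, L)` of increments. -/
def Scheme.count : Scheme → ℕ → ℕ → ℕ
  | .overlapping, n, L => n - L
  | .nonOverlapping, n, L => (n - 1) / L
  | .disjoint, n, L => n / (L + 1)

/-- The `i`-th increment is `p_{(a + L) τ} - p_{a τ}`, where `a = v.start L i`. -/
def Scheme.start : Scheme → ℕ → ℕ → ℕ
  | .overlapping, _, i => i
  | .nonOverlapping, L, i => i * L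
  | .disjoint, L, i => i + i * L

/-- The factor `ζ_v(L)`. -/
def Scheme.zeta : Scheme → ℕ → ℝ
  | .overlapping, _ => 1
  | .nonOverlapping, L => L
  | .disjoint, L => L + 1

/-- The empirical variance `V̂_v(n, L)`, with zero mean, of the increments of duration `L τ` of the
process `p`, observed at the times `0, τ, …, (n - 1) τ`. -/
def empVar {Ω : Type*} (p : ℝ≥0 → Ω → ℝ) (τ : ℝ≥0) (v : Scheme) (n L : ℕ) (ω : Ω) : ℝ :=
  1 / (v.count n L : ℝ) * ∑ i ∈ Finset.range (v.count n L),
    (p (((v.start L i + L : ℕ) : ℝ≥0) * τ) ω - p (((v.start L i : ℕ) : ℝ≥0) * τ) ω) ^ 2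

/-- The estimator `2 (L' V̂_v(n, L) - L V̂_v(n, L')) / (L' - L)` of the squared spread. -/
def spreadEstimator {Ω : Type*} (p : ℝ≥0 → Ω → ℝ) (τ : ℝ≥0) (v : Scheme) (L L' n : ℕ) (ω : Ω) : ℝ :=
  2 / ((L' : ℝ) - L) * (L' * empVar p τ v n L ω - L * empVar p τ v n L' ω)

/-- The variance `V(u)` of a price increment of duration `u`. -/
def incrementVar {Ω : Type*} [MeasurableSpace Ω] (p : ℝ≥0 → Ω → ℝ) (μ : Measure Ω) (u : ℝ≥0) : ℝ :=
  Var[fun ω => p u ω - p 0 ω; μ]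

/-- The mixed moment `K(u, δ) = E[(p_u - p_0)² (p_{2u-δ} - p_{u-δ})²]`, for `δ ≤ u`. -/
def incrementMoment {Ω : Type*} [MeasurableSpace Ω] (p : ℝ≥0 → Ω → ℝ) (μ : Measure Ω)
    (u : ℝ≥0) (δ : ℝ) : ℝ :=
  ∫ ω, (p u ω - p 0 ω) ^ 2 *
    (p (Real.toNNReal (2 * u - δ)) ω - p (Real.toNNReal (u - δ)) ω) ^ 2 ∂μ

/-- The correlation coefficient of two real random variables. -/
def corr {Ω : Type*} [MeasurableSpace Ω] (μ : Measure Ω) (Y Z : Ω → ℝ) : ℝ :=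
  cov[Y, Z; μ] / (√(Var[Y; μ]) * √(Var[Z; μ]))

/-- The constant `σ²_{1,v}(L)`. -/
def sigmaSq (σ S : ℝ) (τ : ℝ≥0) (v : Scheme) (L : ℕ) : ℝ :=
  match v with
  | .overlapping =>
      2 / 3 * σ ^ 4 * L * (1 + 2 * (L : ℝ) ^ 2) * (τ : ℝ) ^ 2 + 2 * σ ^ 2 * L * τ * S ^ 2 + S ^ 4 / 4
  | .nonOverlapping | .disjoint =>
      2 * σ ^ 4 * (L : ℝ) ^ 2 * (τ : ℝ) ^ 2 + 2 * σ ^ 2 * L * τ * S ^ 2 + S ^ 4 / 4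

/-- The asymptotic variance `γ_{1,v}(L, L')`, where `r` stands for the limit of the correlation
coefficients of `V̂_v(n, L)` and `V̂_v(n, L')`. -/
def asympVar (σ S : ℝ) (τ : ℝ≥0) (v : Scheme) (L L' : ℕ) (r : ℝ) : ℝ :=
  4 / ((L' : ℝ) - L) ^ 2 *
    ((L' : ℝ) ^ 2 * v.zeta L * sigmaSq σ S τ v L + (L : ℝ) ^ 2 * v.zeta L' * sigmaSq σ S τ v L'
      - 2 * L * L' * √(v.zeta L * v.zeta L') * √(sigmaSq σ S τ v L) * √(sigmaSq σ S τ v L') * r)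

/-- The explicit variance `Γ(L, L')`. -/
def explicitVar {Ω : Type*} [MeasurableSpace Ω] (p : ℝ≥0 → Ω → ℝ) (μ : Measure Ω) (S : ℝ) (τ : ℝ≥0)
    (L L' : ℕ) : ℝ :=
  let V : ℕ → ℝ := fun l => incrementVar p μ (l * τ)
  let K : ℕ → ℝ := fun l => incrementMoment p μ (l * τ) (l * τ)
  4 * ((L' : ℝ) + 1) / ((L' : ℝ) - L) ^ 2 *
    (L' * (L' * ((L : ℝ) + 1) / (L' + 1) - 2 * L) * (K L - V L ^ 2)
      + (L : ℝ) ^ 2 * (K L' - V L' ^ 2)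
      - 2 * L' * L * (-2 * (((L' : ℝ) - L) / (L' + 1)) * S ^ 2 * V L
          + (3 * (L' : ℝ) - 4 * L - 1) / (L' + 1) * (S ^ 4 / 4)))

end

end BidAskSpread

/-! On the grid of mesh τ, a price increment over L steps is a Brownian increment plus an
independent difference of two noises. With s = σ²τ and e = S²/4 its second moment is sL + 2e: the
diffusive part is linear in L and the noise part is constant. Hence L'·V̂(L) - L·V̂(L') loses the
diffusion in mean and, after normalisation, has mean S².

Everything else concerns the centered squared increments. They are indexed by all grid times and set
to zero at times that are not multiples of the step (1, L or L + 1), so that the three schemes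
become one (`gridSq`). Isserlis' formula for the Gaussian part, and the identity H² = e for the
two-valued noise, give their covariances explicitly (`integral_gridInc_sq_mul_sq`). This kernel
vanishes when two intervals do not overlap, even if they share an endpoint, and is invariant under
translation by a common multiple of the steps. So the covariances of partial sums, divided by n,
converge (`tendsto_sum_sum_div`), and the normalised errors of the empirical variances differ from
such sums by a quantity that is small in L². Consistency and the limit correlation follow.

For asymptotic normality, each centered square depends on a window of at most max(L, L') + 1 terms
of an i.i.d. sequence: the pairs (next Brownian increment, current noise). Long blocks separated by
gaps of length max(L, L') therefore have i.i.d. sums, to which the classical central limit theorem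
applies. The gaps cost little because the variance of a sum over any index set is at most linear in
its cardinality (`tendstoInDistribution_of_block`). The limit variance is a limit of second moments,
hence non-negative.

For strictly disjoint increments the squares themselves are i.i.d., so the strong law applies. If L'
+ 1 = m(L + 1), each long interval contains exactly m short ones, and the mixed covariance rate can
be computed (`tendsto_gridCov_disjoint`), which gives the explicit variance. -/

namespace BidAskSpread

/-! ### Independence of blocks and pairs -/

section Independence

variable {Ω : Type*} [MeasurableSpace Ω] {μ : Measure Ω}

/-- Grouping a countable family of independent variables indexed by pairs into blocks gives
independent blocks. -/
lemma iIndepFun_curry {ι κ E : Type*} [Countable ι] [Countable κ] [MeasurableSpace E]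
    {X : ι → κ → Ω → E} (hX : ∀ i j, AEMeasurable (X i j) μ)
    (h : iIndepFun (fun (p : ι × κ) => X p.1 p.2) μ) :
    iIndepFun (fun i ω j => X i j ω) μ := by
  have := h.isProbabilityMeasure
  have hprob : ∀ i j, IsProbabilityMeasure (μ.map (X i j)) :=
    fun i j => Measure.isProbabilityMeasure_map (hX i j)
  have hblock : ∀ i, AEMeasurable (fun ω j => X i j ω) μ := fun i => aemeasurable_pi_iff.2 (hX i)
  have hpair : AEMeasurable (fun ω (p : ι × κ) => X p.1 p.2 ω) μ :=
    aemeasurable_pi_iff.2 fun p => hX p.1 p.2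
  have hlaw : ∀ i, μ.map (fun ω j => X i j ω) = Measure.infinitePi fun j => μ.map (X i j) := by
    intro i
    exact (h.precomp (g := fun j : κ => (i, j)) (fun a b hab => by simpa using hab)
      ).map_fun_eq_infinitePi_map₀' (hX i)
  -- Independence says that a joint law is a product measure; currying turns the product over pairs
  -- into a product of products.
  rw [iIndepFun_iff_map_fun_eq_infinitePi_map₀' hblock]
  simp_rw [hlaw]
  rw [← Measure.infinitePi_map_curry (fun i j => μ.map (X i j)),
    ← h.map_fun_eq_infinitePi_map₀ hpair,
    AEMeasurable.map_map_of_aemeasurable (MeasurableEquiv.measurable _).aemeasurable hpair]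
  rfl

/-- Casts two independent objects as a family indexed by `Bool`, the form needed to combine two
sequences with `iIndepFun_uncurry'`. -/
lemma iIndepFun_bool {E : Bool → Type*} [∀ b, MeasurableSpace (E b)] [IsProbabilityMeasure μ]
    {X : ∀ b, Ω → E b} (h : IndepFun (X true) (X false) μ) : iIndepFun X μ := by
  rw [iIndepFun_iff_measure_inter_preimage_eq_mul]
  intro S sets hS
  rw [indepFun_iff_measure_inter_preimage_eq_mul] at h
  by_cases ht : true ∈ S <;> by_cases hf : false ∈ S
  · have : S = {true, false} := by ext b; cases b <;> simp [ht, hf]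
    subst this
    rw [Finset.set_biInter_insert, Finset.set_biInter_singleton, Finset.prod_pair (by simp)]
    exact h _ _ (hS _ ht) (hS _ hf)
  · have : S = {true} := by ext b; cases b <;> simp [ht, hf]
    subst this
    simp
  · have : S = {false} := by ext b; cases b <;> simp [ht, hf]
    subst this
    simp
  · have : S = ∅ := by ext b; cases b <;> simp [ht, hf]
    subst this
    simp

/-- Two independent sequences of independent variables form a sequence of independent pairs. -/
lemma iIndepFun_prodMk {E : Type*} [MeasurableSpace E] {X Y : ℕ → Ω → E}
    (hX : ∀ i, AEMeasurable (X i) μ) (hY : ∀ i, AEMeasurable (Y i) μ)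
    (hXi : iIndepFun X μ) (hYi : iIndepFun Y μ)
    (hXY : IndepFun (fun ω i => X i ω) (fun ω i => Y i ω) μ) :
    iIndepFun (fun i ω => (X i ω, Y i ω)) μ := by
  have := hXi.isProbabilityMeasure
  let X' : ℕ → Ω → E := fun i => (hX i).mk
  let Y' : ℕ → Ω → E := fun i => (hY i).mk
  have eX : ∀ i, X i =ᵐ[μ] X' i := fun i => (hX i).ae_eq_mk
  have eY : ∀ i, Y i =ᵐ[μ] Y' i := fun i => (hY i).ae_eq_mk
  have mX : ∀ i, Measurable (X' i) := fun i => (hX i).measurable_mk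
  have mY : ∀ i, Measurable (Y' i) := fun i => (hY i).measurable_mk
  let W : Bool → ℕ → Ω → E := fun b => cond b X' Y'
  have mW : ∀ b i, Measurable (W b i) := by
    intro b i
    cases b
    · exact mY i
    · exact mX i
  have h1 : iIndepFun (fun b ω => (W b · ω)) μ :=
    iIndepFun_bool (hXY.process_congr eX eY)
  have h2 : ∀ b, iIndepFun (W b) μ := by
    intro b
    cases b
    · exact hYi.congr eY
    · exact hXi.congr eX
  have h3 := iIndepFun_uncurry' mW h1 h2
  -- Swapping the indices regroups by time instead of by sequence.
  have h4 : iIndepFun (fun (p : ℕ × Bool) => W p.2 p.1) μ :=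
    h3.precomp (g := Prod.swap) Prod.swap_injective
  have h5 := (iIndepFun_curry (X := fun i b => W b i) (fun i b => (mW b i).aemeasurable) h4).comp
    (fun _ f => (f true, f false)) (fun _ => by fun_prop)
  refine h5.congr fun i => ?_
  filter_upwards [eX i, eY i] with ω h1 h2
  simp [W, h1, h2]

/-- Functions of consecutive disjoint blocks of length `P` of an independent sequence are
independent. -/
lemma iIndepFun_block {E : Type*} [MeasurableSpace E] {Z : ℕ → Ω → E}
    (hZ : ∀ j, AEMeasurable (Z j) μ) (hZi : iIndepFun Z μ) {P : ℕ} (hP : 0 < P)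
    {G : (ℕ → E) → ℝ} (hG : Measurable G) (hGP : ∀ z z', (∀ r < P, z r = z' r) → G z = G z') :
    iIndepFun (fun q ω => G (fun r => Z (q * P + r) ω)) μ := by
  have hinj : Function.Injective (fun p : ℕ × Fin P => p.1 * P + p.2) := by
    rintro ⟨a, r⟩ ⟨b, s⟩ h
    simp only at h
    have ha : (a * P + r) / P = a := by
      rw [mul_comm, Nat.mul_add_div hP, Nat.div_eq_of_lt r.2, add_zero]
    have hb : (b * P + s) / P = b := by
      rw [mul_comm, Nat.mul_add_div hP, Nat.div_eq_of_lt s.2, add_zero]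
    have hab : a = b := by rw [← ha, ← hb, h]
    subst hab
    simp only [Prod.mk.injEq, true_and]
    exact Fin.ext (by omega)
  have h1 := iIndepFun_curry (X := fun (q : ℕ) (r : Fin P) => Z (q * P + r))
    (fun q r => hZ _) (hZi.precomp hinj)
  -- The block is extended periodically to a sequence; the values beyond `P` are immaterial, since
  -- `G` ignores them.
  let ext : (Fin P → E) → ℕ → E := fun z r => z ⟨r % P, Nat.mod_lt _ hP⟩
  have hext : Measurable ext := measurable_pi_lambda _ fun r => measurable_pi_apply _
  refine (h1.comp (fun _ z => G (ext z)) (fun _ => hG.comp hext)).congr fun q => ?_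
  refine ae_of_all _ fun ω => hGP _ _ fun r hr => ?_
  simp [ext, Nat.mod_eq_of_lt hr]

/-- Shifting an independent identically distributed sequence does not change its law. -/
lemma identDistrib_shift {E : Type*} [MeasurableSpace E] {Z : ℕ → Ω → E}
    (hZi : iIndepFun Z μ) (hZd : ∀ j, IdentDistrib (Z j) (Z 0) μ μ)
    {G : (ℕ → E) → ℝ} (hG : Measurable G) (m : ℕ) :
    IdentDistrib (fun ω => G (fun r => Z (m + r) ω)) (fun ω => G (fun r => Z r ω)) μ μ := by
  have hZ : ∀ j, AEMeasurable (Z j) μ := fun j => (hZd j).aemeasurable_fst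
  have h : IdentDistrib (fun ω r => Z (m + r) ω) (fun ω r => Z r ω) μ μ := by
    refine ⟨aemeasurable_pi_iff.2 fun r => hZ _, aemeasurable_pi_iff.2 fun r => hZ _, ?_⟩
    rw [(hZi.precomp (add_right_injective m)).map_fun_eq_infinitePi_map₀' (fun r => hZ _),
      hZi.map_fun_eq_infinitePi_map₀' hZ]
    congr 1
    ext1 r
    rw [(hZd _).map_eq, (hZd r).map_eq]
  exact h.comp hG

end Independence

/-! ### Fourth moments of Gaussian variables -/

section Gaussian

variable {Ω : Type*} [MeasurableSpace Ω] {μ : Measure Ω}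

/-- The moment is the fourth derivative at 0 of the moment generating function. Differentiating
p(t)·exp(vt²/2) replaces p by p' + vXp, so four derivatives reduce to polynomial algebra. -/
lemma integral_pow_four_gaussianReal (v : ℝ≥0) :
    ∫ x, x ^ 4 ∂(gaussianReal 0 v) = 3 * (v : ℝ) ^ 2 := by
  have key : ∀ p : Polynomial ℝ, deriv (fun t => p.eval t * Real.exp (v * t ^ 2 / 2)) =
      fun t => (Polynomial.derivative p + Polynomial.C (v : ℝ) * Polynomial.X * p).eval t *
        Real.exp (v * t ^ 2 / 2) := by
    intro p
    ext t
    have h1 : HasDerivAt (fun t : ℝ => (v : ℝ) * t ^ 2 / 2) (v * t) t := by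
      have := ((hasDerivAt_pow 2 t).const_mul (v : ℝ)).div_const 2
      refine this.congr_deriv ?_
      push_cast
      ring
    refine ((p.hasDerivAt t).fun_mul h1.exp).deriv.trans ?_
    simp only [Polynomial.eval_add, Polynomial.eval_mul, Polynomial.eval_C, Polynomial.eval_X]
    ring
  have h := iteratedDeriv_mgf_zero (X := (id : ℝ → ℝ)) (μ := gaussianReal 0 v) (by simp) 4
  have e0 : mgf id (gaussianReal 0 v) =
      fun t => (1 : Polynomial ℝ).eval t * Real.exp (v * t ^ 2 / 2) := by
    rw [mgf_id_gaussianReal]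
    simp
  rw [iteratedDeriv_succ, iteratedDeriv_succ, iteratedDeriv_succ, iteratedDeriv_succ,
    iteratedDeriv_zero, e0, key, key, key, key] at h
  simp only [Pi.pow_apply, id_eq] at h
  rw [← h]
  simp
  ring

lemma integral_pow_four_of_hasGaussianLaw {Y : Ω → ℝ} (hY : HasGaussianLaw Y μ)
    (h0 : ∫ ω, Y ω ∂μ = 0) : ∫ ω, Y ω ^ 4 ∂μ = 3 * (∫ ω, Y ω ^ 2 ∂μ) ^ 2 := by
  have hm := hY.aemeasurable
  have hmap := hY.map_eq_gaussianReal
  rw [h0] at hmap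
  have h1 : ∫ ω, Y ω ^ 4 ∂μ = ∫ x, x ^ 4 ∂(μ.map Y) := by
    rw [integral_map hm (by fun_prop)]
  have h2 : Var[Y; μ] = ∫ ω, Y ω ^ 2 ∂μ := variance_of_integral_eq_zero hm h0
  rw [h1, hmap, integral_pow_four_gaussianReal, Real.coe_toNNReal _ (variance_nonneg _ _), h2]

lemma integrable_mul_four {B C D E : Ω → ℝ} (hB : MemLp B 4 μ) (hC : MemLp C 4 μ)
    (hD : MemLp D 4 μ) (hE : MemLp E 4 μ) : Integrable (fun ω => B ω * C ω * (D ω * E ω)) μ := by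
  have : ENNReal.HolderTriple 4 4 2 := ⟨by
    have : (4 : ENNReal) = 2 * 2 := by norm_num
    rw [this, ENNReal.mul_inv (by simp) (by simp), ← mul_two, mul_assoc,
      ENNReal.inv_mul_cancel (by simp) (by simp), mul_one]⟩
  have h1 : MemLp (fun ω => B ω * C ω) 2 μ := hC.mul' hB
  have h2 : MemLp (fun ω => D ω * E ω) 2 μ := hE.mul' hD
  exact h1.integrable_mul h2

/-- **Isserlis' theorem** for the squares of two centered jointly Gaussian variables. -/
lemma integral_sq_mul_sq_of_hasGaussianLaw {B C : Ω → ℝ}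
    (h : HasGaussianLaw (fun ω => (B ω, C ω)) μ)
    (hB0 : ∫ ω, B ω ∂μ = 0) (hC0 : ∫ ω, C ω ∂μ = 0) :
    ∫ ω, B ω ^ 2 * C ω ^ 2 ∂μ =
      (∫ ω, B ω ^ 2 ∂μ) * (∫ ω, C ω ^ 2 ∂μ) + 2 * (∫ ω, B ω * C ω ∂μ) ^ 2 := by
  have hB := h.fst
  have hC := h.snd
  have iB := hB.integrable
  have iC := hC.integrable
  have mB : MemLp B 4 μ := hB.memLp (by simp)
  have mC : MemLp C 4 μ := hC.memLp (by simp)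
  have hB4 := integral_pow_four_of_hasGaussianLaw hB hB0
  have hC4 := integral_pow_four_of_hasGaussianLaw hC hC0
  -- Polarisation: B + C and B - C are Gaussian, and adding their fourth moments cancels the odd
  -- terms and isolates E[B²C²].
  have hp := integral_pow_four_of_hasGaussianLaw h.fun_add
    (by rw [integral_add iB iC, hB0, hC0, add_zero])
  have hm := integral_pow_four_of_hasGaussianLaw h.fun_sub
    (by rw [integral_sub iB iC, hB0, hC0, sub_zero])
  have i2B : Integrable (fun ω => B ω ^ 2) μ := hB.memLp_two.integrable_sq
  have i2C : Integrable (fun ω => C ω ^ 2) μ := hC.memLp_two.integrable_sq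
  have iBC : Integrable (fun ω => B ω * C ω) μ := hB.memLp_two.integrable_mul hC.memLp_two
  have i4B : Integrable (fun ω => B ω ^ 4) μ :=
    (integrable_mul_four mB mB mB mB).congr (ae_of_all _ fun ω => by ring)
  have i4C : Integrable (fun ω => C ω ^ 4) μ :=
    (integrable_mul_four mC mC mC mC).congr (ae_of_all _ fun ω => by ring)
  have i22 : Integrable (fun ω => B ω ^ 2 * C ω ^ 2) μ :=
    (integrable_mul_four mB mB mC mC).congr (ae_of_all _ fun ω => by ring)
  have i31 : Integrable (fun ω => B ω ^ 3 * C ω) μ :=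
    (integrable_mul_four mB mB mB mC).congr (ae_of_all _ fun ω => by ring)
  have i13 : Integrable (fun ω => B ω * C ω ^ 3) μ :=
    (integrable_mul_four mB mC mC mC).congr (ae_of_all _ fun ω => by ring)
  have e2 : ∀ s : ℝ, ∫ ω, (B ω ^ 2 + s * (2 * (B ω * C ω)) + C ω ^ 2) ∂μ =
      ∫ ω, B ω ^ 2 ∂μ + s * (2 * ∫ ω, B ω * C ω ∂μ) + ∫ ω, C ω ^ 2 ∂μ := by
    intro s
    rw [integral_add (by fun_prop) i2C, integral_add i2B (by fun_prop), integral_const_mul,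
      integral_const_mul]
  have e4 : ∀ s : ℝ, ∫ ω, (B ω ^ 4 + s * (4 * (B ω ^ 3 * C ω)) + 6 * (B ω ^ 2 * C ω ^ 2)
        + s * (4 * (B ω * C ω ^ 3)) + C ω ^ 4) ∂μ =
      ∫ ω, B ω ^ 4 ∂μ + s * (4 * ∫ ω, B ω ^ 3 * C ω ∂μ) + 6 * ∫ ω, B ω ^ 2 * C ω ^ 2 ∂μ
        + s * (4 * ∫ ω, B ω * C ω ^ 3 ∂μ) + ∫ ω, C ω ^ 4 ∂μ := by
    intro s
    rw [integral_add (by fun_prop) i4C, integral_add (by fun_prop) (by fun_prop),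
      integral_add (by fun_prop) (by fun_prop), integral_add i4B (by fun_prop)]
    simp only [integral_const_mul]
  have p2 := e2 1
  have m2 := e2 (-1)
  have p4 := e4 1
  have m4 := e4 (-1)
  have c1 : ∀ ω, (B ω + C ω) ^ 4 = B ω ^ 4 + 1 * (4 * (B ω ^ 3 * C ω)) + 6 * (B ω ^ 2 * C ω ^ 2)
        + 1 * (4 * (B ω * C ω ^ 3)) + C ω ^ 4 := fun ω => by ring
  have c2 : ∀ ω, (B ω - C ω) ^ 4 = B ω ^ 4 + (-1) * (4 * (B ω ^ 3 * C ω))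
        + 6 * (B ω ^ 2 * C ω ^ 2) + (-1) * (4 * (B ω * C ω ^ 3)) + C ω ^ 4 := fun ω => by ring
  have c3 : ∀ ω, (B ω + C ω) ^ 2 = B ω ^ 2 + 1 * (2 * (B ω * C ω)) + C ω ^ 2 := fun ω => by ring
  have c4 : ∀ ω, (B ω - C ω) ^ 2 = B ω ^ 2 + (-1) * (2 * (B ω * C ω)) + C ω ^ 2 :=
    fun ω => by ring
  simp_rw [c1, c3] at hp
  simp_rw [c2, c4] at hm
  rw [p4, p2, hB4, hC4] at hp
  rw [m4, m2, hB4, hC4] at hm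
  linarith

end Gaussian

/-! ### Approximation tools for the blocking argument -/

section BlockCLT

variable {Ω : Type*} [MeasurableSpace Ω] {μ : Measure Ω}

/-- Iterated limit: for a fixed block size indexed by `N` let n tend to infinity, then let `N` grow;
the error `b N n` need vanish only in this order. -/
lemma tendsto_of_approx {u : ℕ → ℂ} {v : ℕ → ℕ → ℂ} {vl : ℕ → ℂ} {l : ℂ} {b : ℕ → ℕ → ℝ}
    {bl : ℕ → ℝ} (hv : ∀ N, Tendsto (v N) atTop (𝓝 (vl N))) (hvl : Tendsto vl atTop (𝓝 l))
    (hb : ∀ N, Tendsto (b N) atTop (𝓝 (bl N))) (hbl : Tendsto bl atTop (𝓝 0))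
    (h : ∀ N, ∀ᶠ n in atTop, ‖u n - v N n‖ ≤ b N n) : Tendsto u atTop (𝓝 l) := by
  rw [Metric.tendsto_atTop]
  intro ε hε
  obtain ⟨N, hN1, hN2⟩ := ((hbl.eventually (gt_mem_nhds (show 0 < ε / 3 by positivity))).and
    (hvl.eventually (Metric.ball_mem_nhds l (show 0 < ε / 3 by positivity)))).exists
  have h1 := (hb N).eventually (gt_mem_nhds hN1)
  have h2 := (hv N).eventually (Metric.ball_mem_nhds (vl N) (show 0 < ε / 3 by positivity))
  obtain ⟨n₀, hn₀⟩ := eventually_atTop.1 ((h N).and (h1.and h2))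
  refine ⟨n₀, fun n hn => ?_⟩
  obtain ⟨a1, a2, a3⟩ := hn₀ n hn
  rw [← dist_eq_norm] at a1
  calc dist (u n) l ≤ dist (u n) (v N n) + dist (v N n) (vl N) + dist (vl N) l :=
        dist_triangle4 _ _ _ _
    _ < ε / 3 + ε / 3 + ε / 3 := by linarith
    _ = ε := by ring

/-- The Cauchy–Schwarz inequality for square integrable variables. -/
lemma abs_integral_mul_le {X Y : Ω → ℝ} (hX : MemLp X 2 μ) (hY : MemLp Y 2 μ) :
    |∫ ω, X ω * Y ω ∂μ| ≤ √(∫ ω, X ω ^ 2 ∂μ) * √(∫ ω, Y ω ^ 2 ∂μ) := by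
  have iX := hX.integrable_sq
  have iY := hY.integrable_sq
  have iXY : Integrable (fun ω => X ω * Y ω) μ := hX.integrable_mul hY
  -- The quadratic s ↦ E[(sX + Y)²] is non-negative.
  have h := discrim_le_zero (a := ∫ ω, X ω ^ 2 ∂μ) (b := 2 * ∫ ω, X ω * Y ω ∂μ)
    (c := ∫ ω, Y ω ^ 2 ∂μ) fun s => by
    have e : ∫ ω, (s * X ω + Y ω) ^ 2 ∂μ =
        (∫ ω, X ω ^ 2 ∂μ) * (s * s) + (2 * ∫ ω, X ω * Y ω ∂μ) * s + ∫ ω, Y ω ^ 2 ∂μ := by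
      have : ∀ ω, (s * X ω + Y ω) ^ 2 = s * s * X ω ^ 2 + 2 * s * (X ω * Y ω) + Y ω ^ 2 :=
        fun ω => by ring
      simp_rw [this]
      rw [integral_add (by fun_prop) iY, integral_add (by fun_prop) (by fun_prop),
        integral_const_mul, integral_const_mul]
      ring
    rw [← e]
    exact integral_nonneg fun ω => sq_nonneg _
  rw [discrim] at h
  rw [← Real.sqrt_mul (integral_nonneg fun ω => sq_nonneg _)]
  apply Real.abs_le_sqrt
  nlinarith

lemma norm_exp_sub_exp_le (a b : ℝ) :
    ‖Complex.exp (a * Complex.I) - Complex.exp (b * Complex.I)‖ ≤ |a - b| := by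
  have h : Complex.exp (a * Complex.I) - Complex.exp (b * Complex.I) =
      Complex.exp (Complex.I * b) * (Complex.exp (Complex.I * ((a - b : ℝ) : ℂ)) - 1) := by
    rw [mul_sub, ← Complex.exp_add, mul_one]
    push_cast
    ring_nf
  rw [h, norm_mul, Complex.norm_exp_I_mul_ofReal, one_mul]
  exact Real.norm_exp_I_mul_ofReal_sub_one_le

/-- Characteristic functions are Lipschitz for the distance in `L²`. -/
lemma norm_charFun_map_sub_le [IsProbabilityMeasure μ] {X Y : Ω → ℝ} (hX : MemLp X 2 μ)
    (hY : MemLp Y 2 μ) (t : ℝ) :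
    ‖charFun (μ.map X) t - charFun (μ.map Y) t‖ ≤ |t| * √(∫ ω, (X ω - Y ω) ^ 2 ∂μ) := by
  have mX := hX.aestronglyMeasurable.aemeasurable
  have mY := hY.aestronglyMeasurable.aemeasurable
  have hint : ∀ Z : Ω → ℝ, AEMeasurable Z μ →
      Integrable (fun ω => Complex.exp (((t * Z ω : ℝ) : ℂ) * Complex.I)) μ := by
    intro Z hZ
    refine Integrable.of_bound (C := 1) (by fun_prop) (ae_of_all _ fun ω => ?_)
    rw [Complex.norm_exp_ofReal_mul_I]
  have hD : MemLp (fun ω => |X ω - Y ω|) 2 μ := (hX.sub hY).abs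
  rw [charFun_apply_real, charFun_apply_real, integral_map mX (by fun_prop),
    integral_map mY (by fun_prop)]
  simp_rw [← Complex.ofReal_mul]
  rw [← integral_sub (hint X mX) (hint Y mY)]
  calc _ ≤ ∫ ω, |t| * |X ω - Y ω| ∂μ := by
        refine norm_integral_le_of_norm_le ((hD.integrable (by simp)).const_mul _)
          (ae_of_all _ fun ω => (norm_exp_sub_exp_le _ _).trans_eq ?_)
        rw [← mul_sub, abs_mul]
    _ = |t| * ∫ ω, |X ω - Y ω| ∂μ := integral_const_mul _ _
    _ ≤ _ := by
        gcongr
        have h := abs_integral_mul_le hD (memLp_const (1 : ℝ))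
        simp only [mul_one, sq_abs, one_pow, integral_const, probReal_univ, smul_eq_mul,
          Real.sqrt_one] at h
        exact (le_abs_self _).trans h

/-- The indices that lie in one of the first `k` blocks of length `P`, the last `P - Q` indices of
every block being left out. -/
def blockIndices (P Q k : ℕ) : Finset ℕ := (Finset.range (k * P)).filter fun j => j % P < Q

lemma sum_blockIndices {P Q k : ℕ} (hP : 0 < P) (hQ : Q ≤ P) {E : Type*} [AddCommMonoid E]
    (f : ℕ → E) :
    ∑ j ∈ blockIndices P Q k, f j =
      ∑ q ∈ Finset.range k, ∑ r ∈ Finset.range Q, f (q * P + r) := by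
  rw [← Finset.sum_product']
  symm
  refine Finset.sum_nbij' (fun x => x.1 * P + x.2) (fun j => (j / P, j % P)) ?_ ?_ ?_ ?_ ?_
  · rintro ⟨q, r⟩ h
    simp only [Finset.mem_product, Finset.mem_range] at h
    simp only [blockIndices, Finset.mem_filter, Finset.mem_range]
    refine ⟨?_, ?_⟩
    · calc q * P + r < q * P + P := by omega
        _ = (q + 1) * P := by ring
        _ ≤ k * P := Nat.mul_le_mul_right _ h.1
    · rw [mul_comm, Nat.mul_add_mod, Nat.mod_eq_of_lt (by omega)]
      exact h.2
  · intro j h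
    simp only [blockIndices, Finset.mem_filter, Finset.mem_range] at h
    simp only [Finset.mem_product, Finset.mem_range]
    exact ⟨Nat.div_lt_of_lt_mul (by rw [mul_comm]; exact h.1), h.2⟩
  · rintro ⟨q, r⟩ h
    simp only [Finset.mem_product, Finset.mem_range] at h
    have hr : r < P := by omega
    simp only [Prod.mk.injEq]
    constructor
    · rw [mul_comm, Nat.mul_add_div hP, Nat.div_eq_of_lt hr, add_zero]
    · rw [mul_comm, Nat.mul_add_mod, Nat.mod_eq_of_lt hr]
  · intro j _
    simp only
    rw [mul_comm, Nat.div_add_mod]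
  · intro x _
    rfl

lemma card_blockIndices {P Q k : ℕ} (hP : 0 < P) (hQ : Q ≤ P) :
    (blockIndices P Q k).card = k * Q := by
  rw [Finset.card_eq_sum_ones, sum_blockIndices hP hQ]
  simp

lemma tendsto_natDiv_div {P : ℕ} (hP : 0 < P) :
    Tendsto (fun n : ℕ => ((n / P : ℕ) : ℝ) / n) atTop (𝓝 (P : ℝ)⁻¹) := by
  have hP' : (0 : ℝ) < P := by exact_mod_cast hP
  have h : Tendsto (fun n : ℕ => ((n % P : ℕ) : ℝ) / n) atTop (𝓝 0) :=
    tendsto_bdd_div_atTop_nhds_zero (b := 0) (B := P) (Eventually.of_forall fun n => by positivity)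
      (Eventually.of_forall fun n => by exact_mod_cast (Nat.mod_lt _ hP).le)
      tendsto_natCast_atTop_atTop
  have h2 : Tendsto (fun n : ℕ => (P : ℝ)⁻¹ * (1 - ((n % P : ℕ) : ℝ) / n)) atTop
      (𝓝 ((P : ℝ)⁻¹ * (1 - 0))) := (h.const_sub 1).const_mul _
  rw [sub_zero, mul_one] at h2
  refine h2.congr' ?_
  filter_upwards [eventually_gt_atTop 0] with n hn
  have hn' : (n : ℝ) ≠ 0 := by exact_mod_cast hn.ne'
  have e : (n : ℝ) = P * ((n / P : ℕ) : ℝ) + ((n % P : ℕ) : ℝ) := by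
    exact_mod_cast (Nat.div_add_mod n P).symm
  field_simp
  linarith

end BlockCLT

/-! ### Central limit theorem by blocking -/

section BlockCLT

variable {Ω : Type*} [MeasurableSpace Ω] {μ : Measure Ω}

lemma integral_add_sq_le {X Y : Ω → ℝ} (hX : MemLp X 2 μ) (hY : MemLp Y 2 μ) :
    ∫ ω, (X ω + Y ω) ^ 2 ∂μ ≤ 2 * ∫ ω, X ω ^ 2 ∂μ + 2 * ∫ ω, Y ω ^ 2 ∂μ := by
  have iX := hX.integrable_sq
  have iY := hY.integrable_sq
  rw [← integral_const_mul, ← integral_const_mul, ← integral_add (by fun_prop) (by fun_prop)]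
  refine integral_mono (hX.add hY).integrable_sq (by fun_prop) fun ω => ?_
  simp only
  nlinarith [sq_nonneg (X ω - Y ω)]

/-- The variance of the block sums has the same asymptotics as the variance of the partial sums. -/
lemma tendsto_integral_sq_block {w : ℕ → Ω → ℝ} {C γ : ℝ} {T M : ℕ} (hT : 0 < T)
    (hw : ∀ j, MemLp (w j) 2 μ)
    (hvar : ∀ I : Finset ℕ, ∫ ω, (∑ j ∈ I, w j ω) ^ 2 ∂μ ≤ C * I.card)
    (hγ : Tendsto (fun n : ℕ => (∫ ω, (∑ j ∈ Finset.range n, w j ω) ^ 2 ∂μ) / n) atTop (𝓝 γ)) :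
    Tendsto (fun N : ℕ => (∫ ω, (∑ j ∈ Finset.range ((N + 1) * T - M), w j ω) ^ 2 ∂μ) /
      ((N + 1) * T : ℕ)) atTop (𝓝 γ) := by
  have hC : 0 ≤ C := by
    have h := (integral_nonneg fun ω => sq_nonneg _).trans (hvar {0})
    simpa using h
  have hsum : ∀ I : Finset ℕ, MemLp (fun ω => ∑ j ∈ I, w j ω) 2 μ :=
    fun I => memLp_finsetSum I fun j _ => hw j
  have hlim : Tendsto (fun N : ℕ => (N + 1) * T) atTop atTop :=
    tendsto_atTop_mono (fun N => (Nat.le_succ N).trans (Nat.le_mul_of_pos_right _ hT)) tendsto_id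
  have h1 := hγ.comp hlim
  -- Dropping at most M terms from a sum of length P changes its second moment by at most CM +
  -- 2√(CP)√(CM), where the second term comes from Cauchy–Schwarz; this is o(P).
  have hz : Tendsto (fun N : ℕ => (2 * C * √M) * (√((N + 1) * T : ℕ))⁻¹ +
      (C * M) * (((N + 1) * T : ℕ) : ℝ)⁻¹) atTop (𝓝 (2 * C * √M * 0 + C * M * 0)) := by
    have hr : Tendsto (fun N : ℕ => (((N + 1) * T : ℕ) : ℝ)) atTop atTop :=
      tendsto_natCast_atTop_atTop.comp hlim
    exact ((tendsto_inv_atTop_zero.comp (Real.tendsto_sqrt_atTop.comp hr)).const_mul _).add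
      ((tendsto_inv_atTop_zero.comp hr).const_mul _)
  rw [mul_zero, mul_zero, add_zero] at hz
  refine tendsto_of_tendsto_of_dist h1 (squeeze_zero (fun N => dist_nonneg) (fun N => ?_) hz)
  simp only [Function.comp_apply]
  set P := (N + 1) * T with hP
  have hP0 : 0 < P := by positivity
  have hPr : (0 : ℝ) < P := by exact_mod_cast hP0
  set A : Ω → ℝ := fun ω => ∑ j ∈ Finset.range (P - M), w j ω with hA
  set R : Ω → ℝ := fun ω => ∑ j ∈ Finset.range P \ Finset.range (P - M), w j ω with hR
  have hdec : ∀ ω, (∑ j ∈ Finset.range P, w j ω) ^ 2 = R ω ^ 2 + 2 * (A ω * R ω) + A ω ^ 2 := by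
    intro ω
    rw [← Finset.sum_sdiff (Finset.range_subset_range.2 (Nat.sub_le P M))]
    ring
  have mA : MemLp A 2 μ := hsum _
  have mR : MemLp R 2 μ := hsum _
  have iA := mA.integrable_sq
  have iR := mR.integrable_sq
  have iAR : Integrable (fun ω => A ω * R ω) μ := mA.integrable_mul mR
  have eA : ∫ ω, A ω ^ 2 ∂μ ≤ C * P := by
    refine (hvar _).trans ?_
    gcongr
    simp
  have eR : ∫ ω, R ω ^ 2 ∂μ ≤ C * M := by
    refine (hvar _).trans ?_
    rw [Finset.card_sdiff_of_subset (Finset.range_subset_range.2 (Nat.sub_le P M))]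
    gcongr
    simp only [Finset.card_range]
    omega
  have eAR : |∫ ω, A ω * R ω ∂μ| ≤ √(C * P) * √(C * M) :=
    (abs_integral_mul_le mA mR).trans (by gcongr)
  simp_rw [hdec]
  rw [integral_add (by fun_prop) iA, integral_add iR (by fun_prop), integral_const_mul,
    Real.dist_eq, ← sub_div, add_sub_cancel_right, abs_div, abs_of_pos hPr,
    div_le_iff₀ hPr]
  calc _ ≤ |∫ ω, R ω ^ 2 ∂μ| + |2 * ∫ ω, A ω * R ω ∂μ| := abs_add_le _ _
    _ ≤ C * M + 2 * (√(C * P) * √(C * M)) := by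
        rw [abs_mul, abs_two, abs_of_nonneg (integral_nonneg fun ω => sq_nonneg (R ω))]
        gcongr
    _ = _ := by
        have s1 : √(P : ℝ) ≠ 0 := (Real.sqrt_pos.2 hPr).ne'
        have e1 : √(C * P) * √(C * M) = C * √M * √P := by
          rw [Real.sqrt_mul hC, Real.sqrt_mul hC]
          linear_combination (√(P : ℝ) * √M) * Real.mul_self_sqrt hC
        have e2 : (√(P : ℝ))⁻¹ * P = √P := by
          rw [inv_mul_eq_div, Real.div_sqrt]
        rw [e1, add_mul, mul_assoc _ _ (P : ℝ), e2, mul_assoc (C * (M : ℝ)),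
          inv_mul_cancel₀ hPr.ne']
        ring

/-- **Central limit theorem by blocking.** Let `w` be a sequence of centered square integrable
variables such that the variance of a sum grows at most linearly, and such that, for arbitrarily
long blocks, the sums over consecutive blocks with a gap of length `M` are independent and
identically distributed. Then the normalized partial sums are asymptotically normal. -/
theorem tendstoInDistribution_of_block [IsProbabilityMeasure μ] {w : ℕ → Ω → ℝ} {C γ : ℝ}
    {T M : ℕ} (hT : 0 < T) (hw : ∀ j, MemLp (w j) 2 μ) (hw0 : ∀ j, ∫ ω, w j ω ∂μ = 0)
    (hvar : ∀ I : Finset ℕ, ∫ ω, (∑ j ∈ I, w j ω) ^ 2 ∂μ ≤ C * I.card)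
    (hγ : Tendsto (fun n : ℕ => (∫ ω, (∑ j ∈ Finset.range n, w j ω) ^ 2 ∂μ) / n) atTop (𝓝 γ))
    (hind : ∀ N, iIndepFun (fun q ω =>
      ∑ r ∈ Finset.range ((N + 1) * T - M), w (q * ((N + 1) * T) + r) ω) μ)
    (hid : ∀ N q, IdentDistrib
      (fun ω => ∑ r ∈ Finset.range ((N + 1) * T - M), w (q * ((N + 1) * T) + r) ω)
      (fun ω => ∑ r ∈ Finset.range ((N + 1) * T - M), w (0 * ((N + 1) * T) + r) ω) μ μ) :
    TendstoInDistribution (fun (n : ℕ) ω => (√n)⁻¹ * ∑ j ∈ Finset.range n, w j ω) atTop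
      (id : ℝ → ℝ) (fun _ => μ) (gaussianReal 0 γ.toNNReal) := by
  have hC : 0 ≤ C := by
    have h := (integral_nonneg fun ω => sq_nonneg _).trans (hvar {0})
    simpa using h
  have hsum : ∀ I : Finset ℕ, MemLp (fun ω => ∑ j ∈ I, w j ω) 2 μ :=
    fun I => memLp_finsetSum I fun j _ => hw j
  have hγ0 : 0 ≤ γ := ge_of_tendsto' hγ fun n => by positivity
  refine ⟨fun n => ((hsum _).const_mul _).aestronglyMeasurable.aemeasurable, by fun_prop, ?_⟩
  refine ProbabilityMeasure.tendsto_iff_tendsto_charFun.2 fun t => ?_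
  simp only [ProbabilityMeasure.coe_mk, Measure.map_id]
  set P : ℕ → ℕ := fun N => (N + 1) * T with hPdef
  have hP : ∀ N, 0 < P N := fun N => by positivity
  have hPr : ∀ N, (0 : ℝ) < P N := fun N => by exact_mod_cast hP N
  set A : ℕ → ℕ → Ω → ℝ := fun N q ω => ∑ r ∈ Finset.range (P N - M), w (q * P N + r) ω with hA
  set a : ℕ → ℝ := fun N => ∫ ω, (A N 0 ω) ^ 2 ∂μ with ha
  have hAmem : ∀ N q, MemLp (A N q) 2 μ := fun N q => memLp_finsetSum _ fun j _ => hw _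
  have hA0 : ∀ N q, ∫ ω, A N q ω ∂μ = 0 := by
    intro N q
    rw [integral_finsetSum _ fun r _ => (hw _).integrable (by simp)]
    simp [hw0]
  -- the central limit theorem for the block sums
  have hclt : ∀ N, Tendsto (fun n : ℕ =>
      charFun (μ.map fun ω => (√(P N))⁻¹ * ((√(n / P N : ℕ))⁻¹ *
        ∑ q ∈ Finset.range (n / P N), A N q ω)) t) atTop
      (𝓝 (Complex.exp (-(((a N / P N : ℝ) : ℂ) * t ^ 2 / 2)))) := by
    intro N
    have hv : Var[A N 0; μ] = a N := variance_of_integral_eq_zero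
      (hAmem N 0).aestronglyMeasurable.aemeasurable (hA0 N 0)
    have h := tendstoInDistribution_inv_sqrt_mul_sum_sub (P := μ) (X := A N) (Y := (id : ℝ → ℝ))
      (P' := gaussianReal 0 Var[A N 0; μ].toNNReal) ⟨by fun_prop, Measure.map_id⟩ (hAmem N 0)
      (hind N) (hid N)
    -- Evaluation at t/√P turns the block variance `a N` into the variance per unit of time `a N / P
    -- N`.
    have h2 := (ProbabilityMeasure.tendsto_iff_tendsto_charFun.1 h.tendsto) ((√(P N))⁻¹ * t)
    simp only [ProbabilityMeasure.coe_mk, Measure.map_id, hA0, mul_zero, sub_zero] at h2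
    have h3 := h2.comp (Nat.tendsto_div_const_atTop (hP N).ne')
    rw [charFun_gaussianReal, hv] at h3
    refine Tendsto.congr (fun n => ?_) (h3.trans_eq ?_)
    · rw [charFun_map_mul_comp (((memLp_finsetSum _ fun q _ => hAmem N q).const_mul
        _).aestronglyMeasurable.aemeasurable)]
      rfl
    · congr 2
      have e : (((√(P N))⁻¹ : ℝ) : ℂ) ^ 2 = ((P N : ℝ) : ℂ)⁻¹ := by
        rw [← Complex.ofReal_pow, inv_pow, Real.sq_sqrt (hPr N).le, Complex.ofReal_inv]
      rw [Real.coe_toNNReal _ (integral_nonneg fun ω => sq_nonneg _)]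
      push_cast at e ⊢
      rw [mul_pow, e]
      ring
  -- the limit of the variances
  have hlim : Tendsto (fun N => Complex.exp (-(((a N / P N : ℝ) : ℂ) * t ^ 2 / 2))) atTop
      (𝓝 (charFun (gaussianReal 0 γ.toNNReal) t)) := by
    have h := tendsto_integral_sq_block (M := M) hT hw hvar hγ
    have h2 : Tendsto (fun N => a N / P N) atTop (𝓝 γ) := by
      refine h.congr fun N => ?_
      simp [ha, hA, hPdef]
    rw [charFun_gaussianReal, Real.coe_toNNReal _ hγ0]
    have hc : Continuous fun x : ℝ => Complex.exp (-((x : ℂ) * t ^ 2 / 2)) := by fun_prop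
    refine ((hc.tendsto γ).comp h2).trans_eq ?_
    simp
  refine tendsto_of_approx hclt hlim
    -- The first term bounds the indices left out (gaps and incomplete last block), the second the
    -- mismatch between 1/√n and 1/√(kP), where k is the number of blocks. As k/n tends to 1/P, only
    -- 2CM/P remains under the root.
    (b := fun N n => |t| * √(2 * (C * ((1 - (n / P N : ℕ) / n * P N) + M * ((n / P N : ℕ) / n)))
      + 2 * (C * (1 - √((n / P N : ℕ) / n * P N)) ^ 2)))
    (bl := fun N => |t| * √(2 * (C * ((1 - (P N : ℝ)⁻¹ * P N) + M * (P N : ℝ)⁻¹))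
      + 2 * (C * (1 - √((P N : ℝ)⁻¹ * P N)) ^ 2))) ?_ ?_ ?_
  · intro N
    have h := tendsto_natDiv_div (hP N)
    have hc : Continuous fun x : ℝ => |t| * √(2 * (C * ((1 - x * P N) + M * x))
      + 2 * (C * (1 - √(x * P N)) ^ 2)) := by fun_prop
    exact (hc.tendsto _).comp h
  · have h : Tendsto (fun N => (P N : ℝ)⁻¹) atTop (𝓝 0) := by
      refine tendsto_inv_atTop_zero.comp (tendsto_natCast_atTop_atTop.comp ?_)
      exact tendsto_atTop_mono
        (fun N => (Nat.le_succ N).trans (Nat.le_mul_of_pos_right _ hT)) tendsto_id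
    have hc : Continuous fun x : ℝ => |t| * √(2 * (C * (M * x))) := by fun_prop
    refine ((hc.tendsto 0).comp h).congr (fun N => ?_) |>.trans_eq (by simp)
    simp [inv_mul_cancel₀ (hPr N).ne']
  · intro N
    filter_upwards [eventually_ge_atTop (P N)] with n hn
    have hn0 : 0 < n := (hP N).trans_le hn
    have hnr : (0 : ℝ) < n := by exact_mod_cast hn0
    set k := n / P N with hk
    have hk0 : 0 < k := Nat.div_pos hn (hP N)
    have hkr : (0 : ℝ) < k := by exact_mod_cast hk0
    have hkP : k * P N ≤ n := Nat.div_mul_le_self n (P N)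
    set J := blockIndices (P N) (P N - M) k with hJ
    have hJn : J ⊆ Finset.range n := (Finset.filter_subset _ _).trans
      (Finset.range_subset_range.2 hkP)
    have hJcard : J.card = k * (P N - M) := card_blockIndices (hP N) (Nat.sub_le _ _)
    have hJsum : ∀ ω, ∑ q ∈ Finset.range k, A N q ω = ∑ j ∈ J, w j ω := fun ω =>
      (sum_blockIndices (hP N) (Nat.sub_le _ _) (fun j => w j ω)).symm
    have hdec : ∀ ω, ∑ j ∈ Finset.range n, w j ω =
        ∑ j ∈ Finset.range n \ J, w j ω + ∑ j ∈ J, w j ω := fun ω =>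
      (Finset.sum_sdiff hJn).symm
    refine (norm_charFun_map_sub_le ((hsum _).const_mul _)
      (((memLp_finsetSum _ fun q _ => hAmem N q).const_mul _).const_mul _) t).trans ?_
    gcongr
    have e : ∀ ω, (√(n : ℝ))⁻¹ * ∑ j ∈ Finset.range n, w j ω -
        (√(P N))⁻¹ * ((√k)⁻¹ * ∑ q ∈ Finset.range k, A N q ω) =
        (√(n : ℝ))⁻¹ * ∑ j ∈ Finset.range n \ J, w j ω +
          ((√(n : ℝ))⁻¹ - (√(P N))⁻¹ * (√k)⁻¹) * ∑ j ∈ J, w j ω := by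
      intro ω
      rw [hJsum, hdec]
      ring
    simp_rw [e]
    refine (integral_add_sq_le ((hsum _).const_mul _) ((hsum _).const_mul _)).trans ?_
    simp_rw [mul_pow]
    rw [integral_const_mul, integral_const_mul, inv_pow, Real.sq_sqrt hnr.le]
    have b1 : (n : ℝ)⁻¹ * ∫ ω, (∑ j ∈ Finset.range n \ J, w j ω) ^ 2 ∂μ ≤
        C * ((1 - k / n * P N) + M * (k / n)) := by
      have hcard : ((Finset.range n \ J).card : ℝ) ≤ n - k * P N + M * k := by
        rw [Finset.card_sdiff_of_subset hJn, Finset.card_range, hJcard]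
        -- Stated additively, so that it also holds when the truncated difference `P N - M` is zero.
        have h1 : k * P N ≤ k * (P N - M) + M * k := by
          rw [mul_comm M k, ← mul_add]
          exact Nat.mul_le_mul_left _ (by omega)
        have h2 : n - k * (P N - M) + k * P N ≤ n + M * k := by
          have h3 : k * (P N - M) ≤ n := (Nat.mul_le_mul_left _ (Nat.sub_le _ _)).trans hkP
          omega
        have h4 : ((n - k * (P N - M) : ℕ) : ℝ) + k * P N ≤ n + M * k := by exact_mod_cast h2
        linarith
      calc _ ≤ (n : ℝ)⁻¹ * (C * (n - k * P N + M * k)) := by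
            gcongr
            exact (hvar _).trans (by gcongr)
        _ = _ := by field_simp
    have b2 : ((√(n : ℝ))⁻¹ - (√(P N))⁻¹ * (√k)⁻¹) ^ 2 * ∫ ω, (∑ j ∈ J, w j ω) ^ 2 ∂μ ≤
        C * (1 - √(k / n * P N)) ^ 2 := by
      have hcard : (J.card : ℝ) ≤ k * P N := by
        rw [hJcard]
        exact_mod_cast Nat.mul_le_mul_left _ (Nat.sub_le _ _)
      calc _ ≤ ((√(n : ℝ))⁻¹ - (√(P N))⁻¹ * (√k)⁻¹) ^ 2 * (C * (k * P N)) := by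
            gcongr
            exact (hvar _).trans (by gcongr)
        _ = C * (((√(n : ℝ))⁻¹ - (√(P N))⁻¹ * (√k)⁻¹) * √(k * P N)) ^ 2 := by
            rw [mul_pow, Real.sq_sqrt (by positivity)]
            ring
        _ = _ := by
            rw [Real.sqrt_mul hkr.le, Real.sqrt_mul (by positivity), Real.sqrt_div hkr.le]
            have s1 : √(k : ℝ) ≠ 0 := by positivity
            have s2 : √(P N : ℝ) ≠ 0 := (Real.sqrt_pos.2 (hPr N)).ne'
            have s3 : √(n : ℝ) ≠ 0 := by positivity
            congr 1
            have : ((√(n : ℝ))⁻¹ - (√(P N))⁻¹ * (√k)⁻¹) * (√k * √(P N)) =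
                -(1 - √k / √n * √(P N)) := by field_simp; ring
            rw [this, neg_sq]
    linarith

end BlockCLT

/-! ### Averages of periodic sequences and banded kernels -/

section Cesaro

/-- The Cesàro means of an eventually periodic sequence converge to its mean over a period. -/
lemma tendsto_cesaro_of_periodic {e : ℕ → ℝ} {T n₀ : ℕ} (hT : 0 < T)
    (he : ∀ n, n₀ ≤ n → e (n + T) = e n) :
    Tendsto (fun n : ℕ => (∑ i ∈ Finset.range n, e i) / n) atTop
      (𝓝 ((∑ r ∈ Finset.range T, e (n₀ + r)) / T)) := by
  have hTr : (T : ℝ) ≠ 0 := by exact_mod_cast hT.ne'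
  set s := ∑ r ∈ Finset.range T, e (n₀ + r) with hs
  have hwin : ∀ n, n₀ ≤ n → ∑ r ∈ Finset.range T, e (n + r) = s := by
    intro n hn
    induction n, hn using Nat.le_induction with
    | base => rfl
    | succ n hn ih =>
      have h1 := Finset.sum_range_succ (fun r => e (n + r)) T
      have h2 := Finset.sum_range_succ' (fun r => e (n + r)) T
      have h3 : ∀ r, e (n + 1 + r) = e (n + (r + 1)) := fun r => by congr 1; omega
      simp_rw [h3]
      rw [he n hn] at h1
      simp only [add_zero] at h2
      linarith
  -- The partial sums minus their linear trend are eventually periodic, hence bounded, and disappear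
  -- after division by n.
  set F : ℕ → ℝ := fun n => ∑ i ∈ Finset.range n, e i - n * (s / T) with hF
  have hper : ∀ n, n₀ ≤ n → F (n + T) = F n := by
    intro n hn
    simp only [hF]
    rw [Finset.sum_range_add, hwin n hn]
    push_cast
    field_simp
    ring
  set B := ∑ i ∈ Finset.range (n₀ + T), |F i| with hB
  have hbd : ∀ n, |F n| ≤ B := by
    intro n
    induction n using Nat.strong_induction_on with
    | _ n ih =>
      by_cases h : n < n₀ + T
      · exact Finset.single_le_sum (f := fun i => |F i|) (fun i _ => abs_nonneg _)
          (Finset.mem_range.2 h)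
      · have h1 := hper (n - T) (by omega)
        rw [Nat.sub_add_cancel (by omega)] at h1
        rw [h1]
        exact ih _ (by omega)
  have h0 : Tendsto (fun n : ℕ => F n / n) atTop (𝓝 0) :=
    tendsto_bdd_div_atTop_nhds_zero (b := -B) (B := B)
      (Eventually.of_forall fun n => (abs_le.1 (hbd n)).1)
      (Eventually.of_forall fun n => (abs_le.1 (hbd n)).2) tendsto_natCast_atTop_atTop
  have h1 := h0.add_const (s / T)
  rw [zero_add] at h1
  refine h1.congr' ?_
  filter_upwards [eventually_gt_atTop 0] with n hn
  have hn' : (n : ℝ) ≠ 0 := by exact_mod_cast hn.ne'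
  simp only [hF]
  field_simp
  ring

/-- The square is cut into layers of constant max(i, j). For a banded periodic kernel the layer sums
are eventually periodic, so a Cesàro limit applies. -/
lemma sum_sum_range_eq (ρ : ℕ → ℕ → ℝ) (n : ℕ) :
    ∑ i ∈ Finset.range n, ∑ j ∈ Finset.range n, ρ i j =
      ∑ i ∈ Finset.range n,
        (ρ i i + ∑ j ∈ Finset.range i, ρ i j + ∑ j ∈ Finset.range i, ρ j i) := by
  induction n with
  | zero => simp
  | succ n ih =>
    rw [Finset.sum_range_succ (fun i => ρ i i + _ + _), ← ih, Finset.sum_range_succ]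
    simp_rw [Finset.sum_range_succ (fun j => ρ _ j) n]
    rw [Finset.sum_add_distrib]
    ring

/-- The normalized double sums of a banded kernel that is invariant under translation by a period
converge. -/
lemma tendsto_sum_sum_div {ρ : ℕ → ℕ → ℝ} {T M : ℕ} (hT : 0 < T)
    (hper : ∀ i j, ρ (i + T) (j + T) = ρ i j)
    (hband : ∀ i j, i + M ≤ j ∨ j + M ≤ i → ρ i j = 0) {n₀ : ℕ} (hn₀ : M ≤ n₀) :
    Tendsto (fun n : ℕ => (∑ i ∈ Finset.range n, ∑ j ∈ Finset.range n, ρ i j) / n) atTop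
      (𝓝 ((∑ r ∈ Finset.range T, (ρ (n₀ + r) (n₀ + r) + ∑ j ∈ Finset.range (n₀ + r), ρ (n₀ + r) j
        + ∑ j ∈ Finset.range (n₀ + r), ρ j (n₀ + r))) / T)) := by
  simp_rw [sum_sum_range_eq]
  refine tendsto_cesaro_of_periodic
    (e := fun i => ρ i i + ∑ j ∈ Finset.range i, ρ i j + ∑ j ∈ Finset.range i, ρ j i) hT
    fun n hn => ?_
  -- Translating a layer by `T` prepends `T` new indices; since n ≥ `M`, they lie outside the band.
  rw [hper, add_comm n T, Finset.sum_range_add, Finset.sum_range_add,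
    Finset.sum_eq_zero (s := Finset.range T) (f := fun j => ρ (T + n) j),
    Finset.sum_eq_zero (s := Finset.range T) (f := fun j => ρ j (T + n))]
  · simp_rw [add_comm T, hper, zero_add]
  · intro j hj
    rw [Finset.mem_range] at hj
    exact hband _ _ (Or.inl (by omega))
  · intro j hj
    rw [Finset.mem_range] at hj
    exact hband _ _ (Or.inr (by omega))

end Cesaro

/-! ### Combinatorics of the schemes and covariance rates -/

section Kernel

/-- The distance between the beginnings of consecutive price increments. -/
def Scheme.step : Scheme → ℕ → ℕ
  | .overlapping, _ => 1
  | .nonOverlapping, L => L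
  | .disjoint, L => L + 1

lemma Scheme.start_eq (v : Scheme) (L i : ℕ) : v.start L i = i * v.step L := by
  cases v <;> simp only [Scheme.start, Scheme.step] <;> ring

lemma Scheme.zeta_eq (v : Scheme) (L : ℕ) : v.zeta L = v.step L := by
  cases v <;> simp [Scheme.zeta, Scheme.step]

lemma Scheme.step_pos (v : Scheme) {L : ℕ} (hL : 1 ≤ L) : 0 < v.step L := by
  cases v <;> simp only [Scheme.step] <;> omega

/-- Uniform description of the three counts: an increment is used exactly when its last observation
has index below n. -/
lemma Scheme.lt_count_iff (v : Scheme) {L : ℕ} (hL : 1 ≤ L) (n i : ℕ) :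
    i < v.count n L ↔ i * v.step L + L < n := by
  cases v
  · simp only [Scheme.count, Scheme.step]
    omega
  · simp only [Scheme.count, Scheme.step]
    rw [← Nat.add_one_le_iff, Nat.le_div_iff_mul_le (by omega), add_mul, one_mul]
    constructor <;> intro h
    -- Excludes n = 0, where `n - 1` is truncated.
    · have : 1 ≤ i * L + L := by nlinarith [Nat.zero_le (i * L)]
      omega
    · omega
  · simp only [Scheme.count, Scheme.step]
    rw [← Nat.add_one_le_iff, Nat.le_div_iff_mul_le (by omega), add_mul, one_mul]
    omega

/-- Sums over the selected increments are sums over the multiples of the step. -/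
lemma Scheme.sum_count (v : Scheme) {L : ℕ} (hL : 1 ≤ L) (n : ℕ) (f : ℕ → ℝ) :
    ∑ i ∈ Finset.range (v.count n L), f (i * v.step L) =
      ∑ j ∈ Finset.range (n - L), if v.step L ∣ j then f j else 0 := by
  have hs := v.step_pos hL
  rw [← Finset.sum_filter]
  refine Finset.sum_nbij' (fun i => i * v.step L) (fun j => j / v.step L) ?_ ?_ ?_ ?_ ?_
  · intro i hi
    rw [Finset.mem_range, v.lt_count_iff hL] at hi
    simp only [Finset.mem_filter, Finset.mem_range]
    exact ⟨by omega, Dvd.intro_left _ rfl⟩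
  · intro j hj
    simp only [Finset.mem_filter, Finset.mem_range] at hj
    rw [Finset.mem_range, v.lt_count_iff hL, Nat.div_mul_cancel hj.2]
    omega
  · intro i _
    exact Nat.mul_div_cancel _ hs
  · intro j hj
    simp only [Finset.mem_filter] at hj
    exact Nat.div_mul_cancel hj.2
  · intro i _
    rfl

lemma Scheme.count_pos (v : Scheme) {L n : ℕ} (hL : 1 ≤ L) (hn : L < n) : 0 < v.count n L :=
  (v.lt_count_iff hL n 0).2 (by omega)

lemma Scheme.count_mul_le (v : Scheme) {L : ℕ} (hL : 1 ≤ L) (n : ℕ) :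
    v.count n L * v.step L ≤ n + v.step L := by
  rcases Nat.eq_zero_or_pos (v.count n L) with h | h
  · simp [h]
  · have h1 := (v.lt_count_iff hL n (v.count n L - 1)).1 (by omega)
    have h2 : v.count n L * v.step L = (v.count n L - 1) * v.step L + v.step L := by
      rw [← Nat.succ_mul, Nat.succ_eq_add_one, Nat.sub_add_cancel h]
    omega

lemma Scheme.le_count_mul (v : Scheme) {L : ℕ} (hL : 1 ≤ L) (n : ℕ) :
    n ≤ v.count n L * v.step L + L := by
  by_contra! h
  exact lt_irrefl _ ((v.lt_count_iff hL n _).2 h)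

lemma Scheme.tendsto_count_div (v : Scheme) {L : ℕ} (hL : 1 ≤ L) :
    Tendsto (fun n : ℕ => (v.count n L : ℝ) / n) atTop (𝓝 (v.step L : ℝ)⁻¹) := by
  have hs : (0 : ℝ) < v.step L := by exact_mod_cast v.step_pos hL
  have h : Tendsto (fun n : ℕ => ((v.count n L : ℝ) * v.step L - n) / n) atTop (𝓝 0) := by
    refine tendsto_bdd_div_atTop_nhds_zero (b := -L) (B := v.step L)
      (Eventually.of_forall fun n => ?_) (Eventually.of_forall fun n => ?_)
      tendsto_natCast_atTop_atTop
    · have : (n : ℝ) ≤ v.count n L * v.step L + L := by exact_mod_cast v.le_count_mul hL n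
      linarith
    · have : (v.count n L * v.step L : ℝ) ≤ n + v.step L := by exact_mod_cast v.count_mul_le hL n
      linarith
  have h2 := (h.add_const 1).mul_const (v.step L : ℝ)⁻¹
  rw [zero_add, one_mul] at h2
  refine h2.congr' ?_
  filter_upwards [eventually_gt_atTop 0] with n hn
  have hn' : (n : ℝ) ≠ 0 := by exact_mod_cast hn.ne'
  field_simp
  ring

/-- The covariance of the squared increments over `[i, i + L]` and `[j, j + L']`, where `s` is the
variance of the diffusive part per unit of time and `e` the variance of the noise. -/
noncomputable def sqCov (s e : ℝ) (L L' i j : ℕ) : ℝ :=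
  2 * (s * (min (i + L) (j + L') - max i j : ℕ)) ^ 2 +
    4 * (s * (min (i + L) (j + L') - max i j : ℕ)) *
      (e * ((if i + L = j + L' then 1 else 0) + (if i = j then 1 else 0))) +
    (if i = j ∧ L = L' then 4 * e ^ 2 else 0)

lemma sqCov_add (s e : ℝ) (L L' i j T : ℕ) : sqCov s e L L' (i + T) (j + T) = sqCov s e L L' i j := by
  have h1 : min (i + T + L) (j + T + L') - max (i + T) (j + T) = min (i + L) (j + L') - max i j := by
    omega
  have h2 : (i + T + L = j + T + L') ↔ (i + L = j + L') := by omega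
  have h3 : (i + T = j + T) ↔ i = j := by omega
  simp only [sqCov, h1, h2, h3]

/-- The mixed term carries the overlap as a factor and the pure noise term needs equal intervals, so
sharing one endpoint creates no covariance. -/
lemma sqCov_eq_zero (s e : ℝ) {L L' i j : ℕ} (hL : 1 ≤ L) (hL' : 1 ≤ L')
    (h : i + L ≤ j ∨ j + L' ≤ i) : sqCov s e L L' i j = 0 := by
  have h1 : min (i + L) (j + L') - max i j = 0 := by omega
  have h2 : ¬ (i = j ∧ L = L') := by omega
  simp [sqCov, h1, h2]

/-- The covariance kernel of the squared increments selected by a scheme, all instants being used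
as indices. -/
noncomputable def gridCov (s e : ℝ) (v : Scheme) (L L' i j : ℕ) : ℝ :=
  if v.step L ∣ i ∧ v.step L' ∣ j then sqCov s e L L' i j else 0

lemma gridCov_add (s e : ℝ) (v : Scheme) (L L' i j : ℕ) {T : ℕ} (h : v.step L ∣ T)
    (h' : v.step L' ∣ T) : gridCov s e v L L' (i + T) (j + T) = gridCov s e v L L' i j := by
  simp only [gridCov, sqCov_add, Nat.dvd_add_left h, Nat.dvd_add_left h']

lemma gridCov_eq_zero (s e : ℝ) (v : Scheme) {L L' i j : ℕ} (hL : 1 ≤ L) (hL' : 1 ≤ L')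
    (h : i + L ≤ j ∨ j + L' ≤ i) : gridCov s e v L L' i j = 0 := by
  simp [gridCov, sqCov_eq_zero s e hL hL' h]

/-- The limiting covariance rate of the sums of squared increments exists. -/
lemma exists_tendsto_gridCov (s e : ℝ) (v : Scheme) {L L' : ℕ} (hL : 1 ≤ L) (hL' : 1 ≤ L') :
    ∃ c, Tendsto (fun n : ℕ => (∑ i ∈ Finset.range n, ∑ j ∈ Finset.range n,
      gridCov s e v L L' i j) / n) atTop (𝓝 c) :=
  ⟨_, tendsto_sum_sum_div (T := v.step L * v.step L')
    (M := max L L') (Nat.mul_pos (v.step_pos hL) (v.step_pos hL'))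
    (fun i j => gridCov_add s e v L L' i j (Dvd.intro _ rfl) (Dvd.intro_left _ rfl))
    (fun i j h => gridCov_eq_zero s e v hL hL' (by omega)) le_rfl⟩

lemma sum_sq_overlap (L m : ℕ) :
    ∑ j ∈ Finset.range (L + m), ((j + L - (L + m) : ℕ) : ℝ) ^ 2 =
      ((L : ℝ) - 1) * L * (2 * L - 1) / 6 := by
  rw [add_comm L m, Finset.sum_range_add, Finset.sum_eq_zero, zero_add]
  · have h : ∀ j, m + j + L - (m + L) = j := fun j => by omega
    simp_rw [h]
    induction L with
    | zero => simp
    | succ L ih =>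
      rw [Finset.sum_range_succ, ih (fun j => by omega)]
      push_cast
      ring
  · intro j hj
    rw [Finset.mem_range] at hj
    rw [show j + L - (m + L) = 0 by omega]
    simp

/-- The diagonal contributes 2s²L² + 8sLe + 4e². If the step is at least L nothing else overlaps.
For overlapping increments, the distinct pairs add 4s²(1² + ⋯ + (L-1)²), which produces the factor
L(1 + 2L²)/3. -/
lemma tendsto_gridCov_self (σ S : ℝ) (τ : ℝ≥0) (v : Scheme) {L : ℕ} (hL : 1 ≤ L) :
    Tendsto (fun n : ℕ => (∑ i ∈ Finset.range n, ∑ j ∈ Finset.range n,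
      gridCov (σ ^ 2 * τ) (S ^ 2 / 4) v L L i j) / n) atTop
      (𝓝 (sigmaSq σ S τ v L / v.step L)) := by
  set s := σ ^ 2 * (τ : ℝ) with hs
  set e := S ^ 2 / 4 with he
  have hstep := v.step_pos hL
  -- Taking n₀ a multiple of the step leaves a single selected index, r = 0, in the period.
  have h := tendsto_sum_sum_div (ρ := gridCov s e v L L) (T := v.step L) (M := L) hstep
    (fun i j => gridCov_add s e v L L i j dvd_rfl dvd_rfl)
    (fun i j h => gridCov_eq_zero s e v hL hL h) (n₀ := L * v.step L)
    (Nat.le_mul_of_pos_right _ hstep)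
  convert h using 3
  have hdiv : v.step L ∣ L * v.step L := Dvd.intro_left _ rfl
  rw [Finset.sum_eq_single 0]
  · rw [add_zero]
    set n := L * v.step L with hn
    have hdiag : gridCov s e v L L n n = 2 * s ^ 2 * L ^ 2 + 8 * s * L * e + 4 * e ^ 2 := by
      simp [gridCov, sqCov, hdiv]
      ring
    have hsymm : ∀ j ∈ Finset.range n, gridCov s e v L L n j = gridCov s e v L L j n := by
      intro j _
      simp only [gridCov, sqCov, min_comm (n + L), max_comm n, eq_comm (a := n + L),
        eq_comm (a := n), and_comm (a := v.step L ∣ n)]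
    rw [Finset.sum_congr rfl hsymm, hdiag]
    have hoff : ∀ j ∈ Finset.range n, gridCov s e v L L j n =
        if v.step L ∣ j then 2 * s ^ 2 * ((j + L - n : ℕ) : ℝ) ^ 2 else 0 := by
      intro j hj
      rw [Finset.mem_range] at hj
      have h1 : min (j + L) (n + L) - max j n = j + L - n := by omega
      have h2 : ¬ j = n := by omega
      by_cases hd : v.step L ∣ j
      · simp only [gridCov, hd, hdiv, and_self, if_true, sqCov, h1]
        rw [if_neg (by omega : ¬ j + L = n + L), if_neg h2, if_neg fun h => h2 h.1]
        ring
      · simp [gridCov, hd]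
    rw [Finset.sum_congr rfl hoff]
    have hlarge : L ≤ v.step L → ∑ j ∈ Finset.range n,
        (if v.step L ∣ j then 2 * s ^ 2 * ((j + L - n : ℕ) : ℝ) ^ 2 else 0) = 0 := by
      intro hle
      refine Finset.sum_eq_zero fun j hj => ?_
      rw [Finset.mem_range] at hj
      split_ifs with hd
      · have h1 : v.step L ≤ n - j := Nat.le_of_dvd (by omega) (Nat.dvd_sub hdiv hd)
        rw [show j + L - n = 0 by omega]
        simp
      · rfl
    cases v
    -- Written as `L + 0` to match `sum_sq_overlap` with m = 0.
    · have hn' : n = L + 0 := by simp [hn, Scheme.step]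
      simp only [Scheme.step, one_dvd, if_true, ← Finset.mul_sum, hn', sum_sq_overlap,
        sigmaSq, hs, he]
      ring
    · rw [hlarge le_rfl]
      simp only [sigmaSq, hs, he]
      ring
    · rw [hlarge (by simp [Scheme.step])]
      simp only [sigmaSq, hs, he]
      ring
  · intro r hr hr0
    rw [Finset.mem_range] at hr
    have h1 : ¬ v.step L ∣ L * v.step L + r := by
      rw [Nat.dvd_add_right hdiv]
      exact fun h => absurd (Nat.le_of_dvd (by omega) h) (by omega)
    simp [gridCov, h1]
  · intro h
    exact absurd (Finset.mem_range.2 hstep) h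

/-- The limiting covariance rate for strictly disjoint increments, when the longer blocks are unions
of shorter ones. -/
lemma tendsto_gridCov_disjoint (s e : ℝ) {L L' m : ℕ} (hL : 1 ≤ L) (hm : 2 ≤ m)
    (h : L' + 1 = m * (L + 1)) :
    Tendsto (fun n : ℕ => (∑ i ∈ Finset.range n, ∑ j ∈ Finset.range n,
      gridCov s e .disjoint L L' i j) / n) atTop
      (𝓝 ((2 * m * s ^ 2 * L ^ 2 + 8 * s * L * e) / (L' + 1))) := by
  have hLL' : L + 1 ≤ L' := by nlinarith
  have hL' : 1 ≤ L' := by omega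
  have hdT : L + 1 ∣ L' + 1 := h ▸ Dvd.intro_left _ rfl
  -- As L + 1 divides L' + 1, the latter is already a period.
  have hlim := tendsto_sum_sum_div (ρ := gridCov s e .disjoint L L') (T := L' + 1) (M := L')
    (by omega) (fun i j => gridCov_add s e .disjoint L L' i j hdT dvd_rfl)
    (fun i j hij => gridCov_eq_zero s e .disjoint hL hL' (by omega)) (n₀ := L' + 1) (by omega)
  convert hlim using 2
  rw [Nat.cast_add, Nat.cast_one]
  congr 1
  -- In this period only the long interval starting at L' + 1 matters, paired with the short
  -- intervals inside it.
  have hterm : ∀ r ∈ Finset.range (L' + 1),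
      gridCov s e .disjoint L L' (L' + 1 + r) (L' + 1 + r) +
        ∑ j ∈ Finset.range (L' + 1 + r), gridCov s e .disjoint L L' (L' + 1 + r) j +
        ∑ j ∈ Finset.range (L' + 1 + r), gridCov s e .disjoint L L' j (L' + 1 + r) =
      if L + 1 ∣ r then sqCov s e L L' r 0 else 0 := by
    intro r hr
    rw [Finset.mem_range] at hr
    have hshift : gridCov s e .disjoint L L' (L' + 1 + r) (L' + 1) =
        if L + 1 ∣ r then sqCov s e L L' r 0 else 0 := by
      have := gridCov_add s e .disjoint L L' r 0 (T := L' + 1) hdT dvd_rfl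
      rw [zero_add, add_comm r] at this
      rw [this]
      simp [gridCov, Scheme.step]
    rcases Nat.eq_zero_or_pos r with rfl | hr0
    · rw [add_zero] at hshift ⊢
      rw [hshift, Finset.sum_eq_zero, Finset.sum_eq_zero]
      · simp
      · intro j hj
        rw [Finset.mem_range] at hj
        by_cases hd : L + 1 ∣ j
        · have := Nat.le_of_dvd (by omega) (Nat.dvd_sub hdT hd)
          exact gridCov_eq_zero s e _ hL hL' (by omega)
        · simp [gridCov, Scheme.step, hd]
      · intro j hj
        rw [Finset.mem_range] at hj
        by_cases hd : L' + 1 ∣ j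
        · rw [Nat.eq_zero_of_dvd_of_lt hd hj]
          exact gridCov_eq_zero s e _ hL hL' (by omega)
        · simp [gridCov, Scheme.step, hd]
    · have hnd : ¬ L' + 1 ∣ L' + 1 + r := by
        rw [Nat.dvd_add_right dvd_rfl]
        exact fun hd => absurd (Nat.le_of_dvd hr0 hd) (by omega)
      rw [Finset.sum_eq_single (L' + 1), hshift, Finset.sum_eq_zero]
      · simp [gridCov, Scheme.step, hnd]
      · intro j _
        simp [gridCov, Scheme.step, hnd]
      · intro j hj hne
        rw [Finset.mem_range] at hj
        rcases lt_or_gt_of_ne hne with hlt | hgt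
        · by_cases hd : L' + 1 ∣ j
          · rw [Nat.eq_zero_of_dvd_of_lt hd hlt]
            exact gridCov_eq_zero s e _ hL hL' (by omega)
          · simp [gridCov, Scheme.step, hd]
        · have hd : ¬ L' + 1 ∣ j := by
            intro hd
            have := Nat.le_of_dvd (by omega) (Nat.dvd_sub hd (dvd_refl (L' + 1)))
            omega
          simp [gridCov, Scheme.step, hd]
      · intro hn
        exact absurd (Finset.mem_range.2 (by omega)) hn
  rw [Finset.sum_congr rfl hterm]
  have hcount : Scheme.disjoint.count (L' + 1 + L) L = m := by
    simp only [Scheme.count]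
    rw [h, mul_comm, Nat.mul_add_div (by omega), Nat.div_eq_of_lt (by omega), add_zero]
  have hsum : ∑ a ∈ Finset.range m, sqCov s e L L' (a * (L + 1)) 0 =
      ∑ j ∈ Finset.range (L' + 1), if L + 1 ∣ j then sqCov s e L L' j 0 else 0 := by
    have := Scheme.disjoint.sum_count hL (L' + 1 + L) (fun j => sqCov s e L L' j 0)
    rw [hcount, Nat.add_sub_cancel] at this
    convert this <;> rfl
  rw [← hsum]
  -- Every short interval lies inside the long one, so its overlap is L; only the first shares its
  -- left end and only the last its right end, each adding 4sLe.
  have hval : ∀ a ∈ Finset.range m, sqCov s e L L' (a * (L + 1)) 0 =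
      2 * s ^ 2 * L ^ 2 + 4 * s * L * e * (if a = m - 1 then 1 else 0) +
        4 * s * L * e * (if a = 0 then 1 else 0) := by
    intro a ha
    rw [Finset.mem_range] at ha
    have hle : (a + 1) * (L + 1) ≤ m * (L + 1) := Nat.mul_le_mul_right _ ha
    have h1 : min (a * (L + 1) + L) (0 + L') - max (a * (L + 1)) 0 = L := by
      have : (a + 1) * (L + 1) = a * (L + 1) + (L + 1) := by ring
      omega
    have h2 : (a * (L + 1) + L = 0 + L') ↔ a = m - 1 := by
      constructor
      · intro h2
        have h3 : (a + 1) * (L + 1) = m * (L + 1) := by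
          rw [← h]
          linarith
        have := Nat.eq_of_mul_eq_mul_right (by omega) h3
        omega
      · rintro rfl
        have h3 : (m - 1 + 1) * (L + 1) = (m - 1) * (L + 1) + (L + 1) := by ring
        rw [Nat.sub_add_cancel (by omega), ← h] at h3
        omega
    have h3 : a * (L + 1) = 0 ↔ a = 0 := by simp
    have h4 : ¬ (a * (L + 1) = 0 ∧ L = L') := by omega
    simp only [sqCov, h1, h2, h3]
    rw [h3] at h4
    rw [if_neg h4]
    ring
  have hind : ∀ b < m, ∑ a ∈ Finset.range m, (if a = b then (1 : ℝ) else 0) = 1 := by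
    intro b hb
    rw [Finset.sum_ite_eq', if_pos (Finset.mem_range.2 hb)]
  rw [Finset.sum_congr rfl hval, Finset.sum_add_distrib, Finset.sum_add_distrib, ← Finset.mul_sum,
    ← Finset.mul_sum, ← Finset.mul_sum, hind _ (by omega), hind _ (by omega)]
  simp
  ring

end Kernel

/-! ### Second and fourth moments of price increments -/

section GridModel

variable {Ω : Type*} [MeasurableSpace Ω] {μ : Measure Ω} {β H : ℕ → Ω → ℝ} {s e : ℝ}

/-- The market model observed on a regular grid: `β` is a Brownian motion of variance `s` per step
and `H` an independent centered noise of constant square `e`. -/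
structure GridModel (μ : Measure Ω) (β H : ℕ → Ω → ℝ) (s e : ℝ) : Prop where
  gaussian : IsGaussianProcess β μ
  mean : ∀ j, ∫ ω, β j ω ∂μ = 0
  cov : ∀ i j, cov[β i, β j; μ] = s * (min i j : ℕ)
  noise_aemeasurable : ∀ j, AEMeasurable (H j) μ
  noise_ident : ∀ j, IdentDistrib (H j) (H 0) μ μ
  noise_indep : iIndepFun H μ
  noise_mean : ∀ j, ∫ ω, H j ω ∂μ = 0
  noise_sq : ∀ j, ∀ᵐ ω ∂μ, H j ω ^ 2 = e
  increment_indep : iIndepFun (fun j ω => β (j + 1) ω - β j ω) μ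
  indep : IndepFun (fun ω j => β j ω) (fun ω j => H j ω) μ

/-- The price increment over `[j, j + L]`. -/
def gridInc (β H : ℕ → Ω → ℝ) (L j : ℕ) (ω : Ω) : ℝ :=
  (β (j + L) ω - β j ω) + (H (j + L) ω - H j ω)

namespace GridModel

lemma isProbabilityMeasure (h : GridModel μ β H s e) : IsProbabilityMeasure μ :=
  h.noise_indep.isProbabilityMeasure

lemma memLp_diffusion (h : GridModel μ β H s e) (L j : ℕ) {p : ENNReal} (hp : p ≠ ⊤) :
    MemLp (fun ω => β (j + L) ω - β j ω) p μ :=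
  (h.gaussian.hasGaussianLaw_fun_sub (s := j + L) (t := j)).memLp hp

lemma memLp_noise (h : GridModel μ β H s e) (j : ℕ) (p : ENNReal) : MemLp (H j) p μ := by
  have := h.isProbabilityMeasure
  refine MemLp.of_bound (h.noise_aemeasurable j).aestronglyMeasurable (√e) ?_
  filter_upwards [h.noise_sq j] with ω hω
  rw [← hω, Real.sqrt_sq_eq_abs, Real.norm_eq_abs]

lemma memLp_noise_sub (h : GridModel μ β H s e) (L j : ℕ) (p : ENNReal) :
    MemLp (fun ω => H (j + L) ω - H j ω) p μ :=
  (h.memLp_noise _ p).sub (h.memLp_noise _ p)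

lemma memLp_gridInc (h : GridModel μ β H s e) (L j : ℕ) {p : ENNReal} (hp : p ≠ ⊤) :
    MemLp (gridInc β H L j) p μ :=
  (h.memLp_diffusion L j hp).add (h.memLp_noise_sub L j p)

lemma integral_diffusion (h : GridModel μ β H s e) (L j : ℕ) :
    ∫ ω, (β (j + L) ω - β j ω) ∂μ = 0 := by
  rw [integral_sub (h.gaussian.hasGaussianLaw_eval _).integrable
    (h.gaussian.hasGaussianLaw_eval _).integrable, h.mean, h.mean, sub_zero]

lemma integral_diffusion_mul (h : GridModel μ β H s e) (L L' i j : ℕ) :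
    ∫ ω, (β (i + L) ω - β i ω) * (β (j + L') ω - β j ω) ∂μ =
      s * (min (i + L) (j + L') - max i j : ℕ) := by
  have := h.isProbabilityMeasure
  have hm : ∀ j, MemLp (β j) 2 μ := fun j => (h.gaussian.hasGaussianLaw_eval j).memLp_two
  have h1 := covariance_eq_sub (h.memLp_diffusion L i (p := 2) (by simp))
    (h.memLp_diffusion L' j (p := 2) (by simp))
  rw [h.integral_diffusion, zero_mul, sub_zero,
    covariance_fun_sub_fun_sub (hm _) (hm _) (hm _) (hm _), h.cov, h.cov, h.cov, h.cov] at h1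
  -- The four Brownian covariances combine into the length of the overlap; the truncated subtraction
  -- makes it zero for disjoint intervals.
  have h2 : min (i + L) (j + L') + min i j =
      (min (i + L) (j + L') - max i j) + min (i + L) j + min i (j + L') := by omega
  have h3 : ((min (i + L) (j + L') : ℕ) : ℝ) + (min i j : ℕ) =
      (min (i + L) (j + L') - max i j : ℕ) + (min (i + L) j : ℕ) + (min i (j + L') : ℕ) := by
    exact_mod_cast h2
  simp only [Pi.mul_apply] at h1
  rw [← h1]
  linear_combination s * h3

lemma integral_diffusion_sq_mul_sq (h : GridModel μ β H s e) (L L' i j : ℕ) :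
    ∫ ω, (β (i + L) ω - β i ω) ^ 2 * (β (j + L') ω - β j ω) ^ 2 ∂μ =
      (s * L) * (s * L') + 2 * (s * (min (i + L) (j + L') - max i j : ℕ)) ^ 2 := by
  have hpair : HasGaussianLaw
      (fun ω => (β (i + L) ω - β i ω, β (j + L') ω - β j ω)) μ := by
    have h1 := h.gaussian.hasGaussianLaw {i + L, i, j + L', j}
    let f : ∀ k ∈ ({i + L, i, j + L', j} : Finset ℕ),
      (({i + L, i, j + L', j} : Finset ℕ) → ℝ) →L[ℝ] ℝ :=
        fun k hk => ContinuousLinearMap.proj (R := ℝ) (φ := fun _ => ℝ) ⟨k, hk⟩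
    exact h1.map_fun (((f (i + L) (by simp)) - f i (by simp)).prod
      (f (j + L') (by simp) - f j (by simp)))
  rw [integral_sq_mul_sq_of_hasGaussianLaw hpair (h.integral_diffusion _ _)
    (h.integral_diffusion _ _), h.integral_diffusion_mul]
  have hsq : ∀ L i, ∫ ω, (β (i + L) ω - β i ω) ^ 2 ∂μ = s * L := by
    intro L i
    simp_rw [pow_two]
    rw [h.integral_diffusion_mul]
    simp
  rw [hsq, hsq]

lemma integral_noise_mul (h : GridModel μ β H s e) (a b : ℕ) :
    ∫ ω, H a ω * H b ω ∂μ = if a = b then e else 0 := by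
  have := h.isProbabilityMeasure
  split_ifs with hab
  · subst hab
    rw [integral_congr_ae (g := fun _ => e)]
    · simp
    · filter_upwards [h.noise_sq a] with ω hω
      rw [← hω, pow_two]
  · rw [(h.noise_indep.indepFun hab).integral_fun_mul_eq_mul_integral
      (h.noise_aemeasurable a).aestronglyMeasurable (h.noise_aemeasurable b).aestronglyMeasurable,
      h.noise_mean, zero_mul]

lemma integrable_noise_mul (h : GridModel μ β H s e) (a b : ℕ) :
    Integrable (fun ω => H a ω * H b ω) μ :=
  (h.memLp_noise a 2).integrable_mul (h.memLp_noise b 2)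

lemma integral_noise_sub (h : GridModel μ β H s e) (L j : ℕ) :
    ∫ ω, (H (j + L) ω - H j ω) ∂μ = 0 := by
  have := h.isProbabilityMeasure
  rw [integral_sub ((h.memLp_noise _ 1).integrable le_rfl) ((h.memLp_noise _ 1).integrable le_rfl),
    h.noise_mean, h.noise_mean, sub_zero]

lemma integral_noise_sub_mul (h : GridModel μ β H s e) (L L' i j : ℕ) :
    ∫ ω, (H (i + L) ω - H i ω) * (H (j + L') ω - H j ω) ∂μ =
      e * ((if i + L = j + L' then 1 else 0) + (if i = j then 1 else 0)
        - (if i + L = j then 1 else 0) - (if i = j + L' then 1 else 0)) := by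
  have hint := h.integrable_noise_mul
  have h1 : ∀ ω, (H (i + L) ω - H i ω) * (H (j + L') ω - H j ω) =
      (H (i + L) ω * H (j + L') ω + H i ω * H j ω) -
        (H (i + L) ω * H j ω + H i ω * H (j + L') ω) := fun ω => by ring
  have i1 := hint (i + L) (j + L')
  have i2 := hint i j
  have i3 := hint (i + L) j
  have i4 := hint i (j + L')
  simp_rw [h1]
  rw [integral_sub (by fun_prop) (by fun_prop), integral_add i1 i2, integral_add i3 i4]
  simp only [h.integral_noise_mul]
  split_ifs <;> ring

lemma integral_noise_sub_sq (h : GridModel μ β H s e) {L : ℕ} (hL : 1 ≤ L) (j : ℕ) :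
    ∫ ω, (H (j + L) ω - H j ω) ^ 2 ∂μ = 2 * e := by
  simp_rw [pow_two]
  rw [h.integral_noise_sub_mul, if_pos rfl, if_pos rfl, if_neg (by omega), if_neg (by omega)]
  ring

/-- A noise whose index occurs only once is independent of the remaining factors and has mean zero;
`p`, `q`, `r` may coincide. -/
lemma integral_noise_mul_of_notMem (h : GridModel μ β H s e) {x p q r : ℕ}
    (hp : x ≠ p) (hq : x ≠ q) (hr : x ≠ r) :
    ∫ ω, H x ω * (H p ω * H q ω * H r ω) ∂μ = 0 := by
  have hd : Disjoint ({x} : Finset ℕ) {p, q, r} := by simp [hp, hq, hr]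
  have hmeas : Measurable (fun f : ({p, q, r} : Finset ℕ) → ℝ =>
      f ⟨p, by simp⟩ * f ⟨q, by simp⟩ * f ⟨r, by simp⟩) := by
    refine Measurable.mul (Measurable.mul ?_ ?_) ?_ <;> exact measurable_pi_apply _
  have hmeas' : Measurable (fun f : ({x} : Finset ℕ) → ℝ => f ⟨x, by simp⟩) :=
    measurable_pi_apply _
  have h1 := (h.noise_indep.indepFun_finset₀ {x} {p, q, r} hd h.noise_aemeasurable).comp
    (φ := fun f : ({x} : Finset ℕ) → ℝ => f ⟨x, by simp⟩)
    (ψ := fun f : ({p, q, r} : Finset ℕ) → ℝ =>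
      f ⟨p, by simp⟩ * f ⟨q, by simp⟩ * f ⟨r, by simp⟩)
    hmeas' hmeas
  have hm := fun j => h.noise_aemeasurable j
  have h2 : ∫ ω, H x ω * (H p ω * H q ω * H r ω) ∂μ =
      (∫ ω, H x ω ∂μ) * ∫ ω, H p ω * H q ω * H r ω ∂μ :=
    h1.integral_fun_mul_eq_mul_integral (hm x).aestronglyMeasurable
      (((hm p).mul (hm q)).mul (hm r)).aestronglyMeasurable
  rw [h2, h.noise_mean, zero_mul]

lemma integral_noise_mul_mul (h : GridModel μ β H s e) {a b c d : ℕ} (hab : a < b) (hcd : c < d) :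
    ∫ ω, H a ω * H b ω * (H c ω * H d ω) ∂μ = if a = c ∧ b = d then e ^ 2 else 0 := by
  have := h.isProbabilityMeasure
  split_ifs with hc
  · obtain ⟨rfl, rfl⟩ := hc
    rw [integral_congr_ae (g := fun _ => e ^ 2)]
    · simp
    · filter_upwards [h.noise_sq a, h.noise_sq b] with ω h1 h2
      calc _ = H a ω ^ 2 * H b ω ^ 2 := by ring
        _ = e ^ 2 := by rw [h1, h2, pow_two]
  -- Two distinct pairs leave an index unmatched. If a belongs to {c, d}, the ordering a < b, c < d
  -- forces b outside it.
  · by_cases h1 : a = c ∨ a = d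
    · have h2 : b ≠ c ∧ b ≠ d := by omega
      rw [← h.integral_noise_mul_of_notMem (x := b) (p := a) (q := c) (r := d) (by omega) h2.1 h2.2]
      congr 1 with ω
      ring
    · rw [← h.integral_noise_mul_of_notMem (x := a) (p := b) (q := c) (r := d) (by omega)
        (by omega) (by omega)]
      congr 1 with ω
      ring

/-- As H² = e almost surely, the square of a noise difference is 2e minus twice a product of two
noises, and such products are orthogonal unless they use the same pair of times. -/
lemma integral_noise_sub_sq_mul_sq (h : GridModel μ β H s e) {L L' : ℕ} (hL : 1 ≤ L) (hL' : 1 ≤ L')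
    (i j : ℕ) :
    ∫ ω, (H (i + L) ω - H i ω) ^ 2 * (H (j + L') ω - H j ω) ^ 2 ∂μ =
      4 * e ^ 2 + if i = j ∧ L = L' then 4 * e ^ 2 else 0 := by
  have := h.isProbabilityMeasure
  have hint := h.integrable_noise_mul
  have h4 : ∀ j, MemLp (H j) 4 μ := fun j => h.memLp_noise j 4
  have i4 : Integrable (fun ω => H i ω * H (i + L) ω * (H j ω * H (j + L') ω)) μ :=
    integrable_mul_four (h4 _) (h4 _) (h4 _) (h4 _)
  rw [integral_congr_ae (g := fun ω => 4 * e ^ 2 - 4 * e * (H i ω * H (i + L) ω)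
    - 4 * e * (H j ω * H (j + L') ω) + 4 * (H i ω * H (i + L) ω * (H j ω * H (j + L') ω)))]
  · have i1 := hint i (i + L)
    have i2 := hint j (j + L')
    rw [integral_add (by fun_prop) (by fun_prop), integral_sub (by fun_prop) (by fun_prop),
      integral_sub (by fun_prop) (by fun_prop)]
    simp only [integral_const_mul (μ := μ) (4 * e), integral_const_mul (μ := μ) 4
      (fun ω => H i ω * H (i + L) ω * (H j ω * H (j + L') ω)), integral_const, probReal_univ,
      one_smul]
    rw [h.integral_noise_mul, h.integral_noise_mul,
      h.integral_noise_mul_mul (by omega) (by omega), if_neg (by omega), if_neg (by omega)]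
    have hiff : (i = j ∧ i + L = j + L') ↔ (i = j ∧ L = L') := by omega
    simp only [hiff]
    split_ifs <;> simp
  · filter_upwards [h.noise_sq i, h.noise_sq (i + L), h.noise_sq j, h.noise_sq (j + L')]
      with ω h1 h2 h3 h4
    have e1 : (H (i + L) ω - H i ω) ^ 2 = 2 * e - 2 * (H i ω * H (i + L) ω) := by
      linear_combination h1 + h2
    have e2 : (H (j + L') ω - H j ω) ^ 2 = 2 * e - 2 * (H j ω * H (j + L') ω) := by
      linear_combination h3 + h4
    rw [e1, e2]
    ring

lemma integral_mul_of_indep (h : GridModel μ β H s e) (L L' i j : ℕ) {f g : ℝ × ℝ → ℝ}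
    (hf : Continuous f) (hg : Continuous g) :
    ∫ ω, f (β (i + L) ω - β i ω, β (j + L') ω - β j ω) *
      g (H (i + L) ω - H i ω, H (j + L') ω - H j ω) ∂μ =
    (∫ ω, f (β (i + L) ω - β i ω, β (j + L') ω - β j ω) ∂μ) *
      ∫ ω, g (H (i + L) ω - H i ω, H (j + L') ω - H j ω) ∂μ := by
  have hb := fun j => h.gaussian.aemeasurable j
  have hn := fun j => h.noise_aemeasurable j
  have h1 := h.indep.comp
    (φ := fun x : ℕ → ℝ => f (x (i + L) - x i, x (j + L') - x j))
    (ψ := fun x : ℕ → ℝ => g (x (i + L) - x i, x (j + L') - x j))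
    (hf.measurable.comp (by fun_prop)) (hg.measurable.comp (by fun_prop))
  exact h1.integral_fun_mul_eq_mul_integral
    (hf.measurable.comp_aemeasurable (((hb _).sub (hb _)).prodMk
      ((hb _).sub (hb _)))).aestronglyMeasurable
    (hg.measurable.comp_aemeasurable (((hn _).sub (hn _)).prodMk
      ((hn _).sub (hn _)))).aestronglyMeasurable

lemma integral_gridInc (h : GridModel μ β H s e) (L j : ℕ) : ∫ ω, gridInc β H L j ω ∂μ = 0 := by
  have := h.isProbabilityMeasure
  simp only [gridInc]
  rw [integral_add ((h.memLp_diffusion L j (p := 1) (by simp)).integrable le_rfl)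
    ((h.memLp_noise_sub L j 1).integrable le_rfl), h.integral_diffusion, h.integral_noise_sub,
    add_zero]

lemma integral_gridInc_sq (h : GridModel μ β H s e) {L : ℕ} (hL : 1 ≤ L) (j : ℕ) :
    ∫ ω, gridInc β H L j ω ^ 2 ∂μ = s * L + 2 * e := by
  have hB := h.memLp_diffusion L j (p := 2) (by simp)
  have hN := h.memLp_noise_sub L j 2
  have iB := hB.integrable_sq
  have iN := hN.integrable_sq
  have iBN : Integrable (fun ω => (β (j + L) ω - β j ω) * (H (j + L) ω - H j ω)) μ :=
    hB.integrable_mul hN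
  have h1 : ∀ ω, gridInc β H L j ω ^ 2 = (β (j + L) ω - β j ω) ^ 2 +
      2 * ((β (j + L) ω - β j ω) * (H (j + L) ω - H j ω)) + (H (j + L) ω - H j ω) ^ 2 :=
    fun ω => by
      simp only [gridInc]
      ring
  simp_rw [h1]
  rw [integral_add (by fun_prop) iN, integral_add iB (by fun_prop), integral_const_mul,
    h.integral_mul_of_indep L L j j (f := fun x => x.1) (g := fun x => x.1) (by fun_prop)
      (by fun_prop), h.integral_diffusion, h.integral_noise_sub_sq hL]
  simp_rw [pow_two]
  rw [h.integral_diffusion_mul]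
  simp

/-- Expand both squares and factor each term into diffusion and noise. Terms with a lone first power
of either part vanish; Isserlis' formula, the product E[BB']·E[NN'] and the fourth noise moment
account for `sqCov`. -/
lemma integral_gridInc_sq_mul_sq (h : GridModel μ β H s e) {L L' : ℕ} (hL : 1 ≤ L) (hL' : 1 ≤ L')
    (i j : ℕ) :
    ∫ ω, gridInc β H L i ω ^ 2 * gridInc β H L' j ω ^ 2 ∂μ =
      (s * L + 2 * e) * (s * L' + 2 * e) + sqCov s e L L' i j := by
  have hB := h.memLp_diffusion L i (p := 4) (by simp)
  have hB' := h.memLp_diffusion L' j (p := 4) (by simp)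
  have hN := h.memLp_noise_sub L i 4
  have hN' := h.memLp_noise_sub L' j 4
  have key := fun (f g : ℝ × ℝ → ℝ) (hf : Continuous f) (hg : Continuous g) =>
    h.integral_mul_of_indep L L' i j hf hg
  have eB : ∫ ω, (β (i + L) ω - β i ω) ^ 2 ∂μ = s * L := by
    simp_rw [pow_two]
    rw [h.integral_diffusion_mul]
    simp
  have eB' : ∫ ω, (β (j + L') ω - β j ω) ^ 2 ∂μ = s * L' := by
    simp_rw [pow_two]
    rw [h.integral_diffusion_mul]
    simp
  have t1 := h.integral_diffusion_sq_mul_sq L L' i j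
  have t2 := key (fun x => x.1 ^ 2 * x.2) (fun x => x.2) (by fun_prop) (by fun_prop)
  have t3 := key (fun x => x.1 ^ 2) (fun x => x.2 ^ 2) (by fun_prop) (by fun_prop)
  have t4 := key (fun x => x.1 * x.2 ^ 2) (fun x => x.1) (by fun_prop) (by fun_prop)
  have t5 := key (fun x => x.1 * x.2) (fun x => x.1 * x.2) (by fun_prop) (by fun_prop)
  have t6 := key (fun x => x.1) (fun x => x.1 * x.2 ^ 2) (by fun_prop) (by fun_prop)
  have t7 := key (fun x => x.2 ^ 2) (fun x => x.1 ^ 2) (by fun_prop) (by fun_prop)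
  have t8 := key (fun x => x.2) (fun x => x.1 ^ 2 * x.2) (by fun_prop) (by fun_prop)
  have t9 := h.integral_noise_sub_sq_mul_sq hL hL' i j
  simp only [h.integral_noise_sub, h.integral_diffusion, mul_zero, zero_mul, eB, eB',
    h.integral_noise_sub_sq hL, h.integral_noise_sub_sq hL', h.integral_diffusion_mul,
    h.integral_noise_sub_mul] at t2 t3 t4 t5 t6 t7 t8
  set B := fun ω => β (i + L) ω - β i ω with hBdef
  set B' := fun ω => β (j + L') ω - β j ω with hBdef'
  set N := fun ω => H (i + L) ω - H i ω with hNdef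
  set N' := fun ω => H (j + L') ω - H j ω with hNdef'
  have i1 : Integrable (fun ω => B ω ^ 2 * B' ω ^ 2) μ :=
    (integrable_mul_four hB hB hB' hB').congr (ae_of_all _ fun ω => by ring)
  have i2 : Integrable (fun ω => B ω ^ 2 * B' ω * N' ω) μ :=
    (integrable_mul_four hB hB hB' hN').congr (ae_of_all _ fun ω => by ring)
  have i3 : Integrable (fun ω => B ω ^ 2 * N' ω ^ 2) μ :=
    (integrable_mul_four hB hB hN' hN').congr (ae_of_all _ fun ω => by ring)
  have i4 : Integrable (fun ω => B ω * B' ω ^ 2 * N ω) μ :=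
    (integrable_mul_four hB hB' hB' hN).congr (ae_of_all _ fun ω => by ring)
  have i5 : Integrable (fun ω => B ω * B' ω * (N ω * N' ω)) μ :=
    (integrable_mul_four hB hB' hN hN').congr (ae_of_all _ fun ω => by ring)
  have i6 : Integrable (fun ω => B ω * (N ω * N' ω ^ 2)) μ :=
    (integrable_mul_four hB hN hN' hN').congr (ae_of_all _ fun ω => by ring)
  have i7 : Integrable (fun ω => B' ω ^ 2 * N ω ^ 2) μ :=
    (integrable_mul_four hB' hB' hN hN).congr (ae_of_all _ fun ω => by ring)
  have i8 : Integrable (fun ω => B' ω * (N ω ^ 2 * N' ω)) μ :=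
    (integrable_mul_four hB' hN hN hN').congr (ae_of_all _ fun ω => by ring)
  have i9 : Integrable (fun ω => N ω ^ 2 * N' ω ^ 2) μ :=
    (integrable_mul_four hN hN hN' hN').congr (ae_of_all _ fun ω => by ring)
  have hexp : ∀ ω, gridInc β H L i ω ^ 2 * gridInc β H L' j ω ^ 2 =
      B ω ^ 2 * B' ω ^ 2 + 2 * (B ω ^ 2 * B' ω * N' ω) + B ω ^ 2 * N' ω ^ 2
      + 2 * (B ω * B' ω ^ 2 * N ω) + 4 * (B ω * B' ω * (N ω * N' ω))
      + 2 * (B ω * (N ω * N' ω ^ 2)) + B' ω ^ 2 * N ω ^ 2 + 2 * (B' ω * (N ω ^ 2 * N' ω))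
      + N ω ^ 2 * N' ω ^ 2 := fun ω => by
    simp only [gridInc, hBdef, hBdef', hNdef, hNdef']
    ring
  simp_rw [hexp]
  rw [integral_add (by fun_prop) i9, integral_add (by fun_prop) (by fun_prop),
    integral_add (by fun_prop) i7, integral_add (by fun_prop) (by fun_prop),
    integral_add (by fun_prop) (by fun_prop), integral_add (by fun_prop) (by fun_prop),
    integral_add (by fun_prop) i3, integral_add i1 (by fun_prop)]
  simp only [integral_const_mul]
  rw [t1, t2, t3, t4, t5, t6, t7, t8, t9]
  -- The negative terms of E[NN'] occur only when one interval ends where the other begins; there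
  -- E[BB'] is zero.
  have hov : (i + L = j ∨ i = j + L') → (min (i + L) (j + L') - max i j : ℕ) = 0 := by omega
  simp only [sqCov]
  by_cases hc : i + L = j ∨ i = j + L'
  · rw [hov hc]
    simp
    ring
  · push Not at hc
    rw [if_neg hc.1, if_neg hc.2]
    ring

end GridModel

end GridModel

/-! ### Linear bound on covariance sums -/

section Kernel

lemma gridCov_abs_le (s e : ℝ) (v : Scheme) (L L' i j : ℕ) :
    |gridCov s e v L L' i j| ≤ 2 * s ^ 2 * L ^ 2 + 8 * |s| * L * |e| + 4 * e ^ 2 := by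
  have hnn : 0 ≤ 2 * s ^ 2 * (L : ℝ) ^ 2 + 8 * |s| * L * |e| + 4 * e ^ 2 := by positivity
  rw [gridCov]
  split_ifs
  · have ho : ((min (i + L) (j + L') - max i j : ℕ) : ℝ) ≤ L := by
      have : min (i + L) (j + L') - max i j ≤ L := by omega
      exact_mod_cast this
    rw [sqCov]
    set o : ℝ := ((min (i + L) (j + L') - max i j : ℕ) : ℝ) with ho_def
    have ho0 : 0 ≤ o := by positivity
    have h1 : |2 * (s * o) ^ 2| ≤ 2 * s ^ 2 * L ^ 2 := by
      rw [abs_of_nonneg (by positivity), mul_pow, mul_assoc]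
      gcongr
    have h2 : |(if i + L = j + L' then (1 : ℝ) else 0) + (if i = j then 1 else 0)| ≤ 2 := by
      split_ifs <;> norm_num
    have h3 : |4 * (s * o) * (e * ((if i + L = j + L' then 1 else 0) + (if i = j then 1 else 0)))|
        ≤ 8 * |s| * L * |e| := by
      rw [abs_mul, abs_mul, abs_mul, abs_mul, abs_of_nonneg ho0, abs_of_pos (by norm_num : (0:ℝ) < 4)]
      calc _ ≤ 4 * (|s| * L) * (|e| * 2) := by gcongr
        _ = _ := by ring
    have h4 : |if i = j ∧ L = L' then 4 * e ^ 2 else 0| ≤ 4 * e ^ 2 := by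
      split_ifs
      · rw [abs_of_nonneg (by positivity)]
      · simp; positivity
    exact (abs_add_three _ _ _).trans (add_le_add_three h1 h3 h4)
  · simpa using hnn

/-- A bounded kernel with at most L + L' non-zero entries per row. Arbitrary finite sets are needed
because the indices discarded by blocking do not form an interval. -/
lemma exists_sum_gridCov_le (s e : ℝ) (v : Scheme) {L L' : ℕ} (hL : 1 ≤ L) (hL' : 1 ≤ L') :
    ∃ C, 0 ≤ C ∧ ∀ I : Finset ℕ, ∑ i ∈ I, ∑ j ∈ I, gridCov s e v L L' i j ≤ C * I.card := by
  set K := 2 * s ^ 2 * (L : ℝ) ^ 2 + 8 * |s| * L * |e| + 4 * e ^ 2 with hK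
  have hK0 : 0 ≤ K := by positivity
  refine ⟨(L + L' : ℕ) * K, by positivity, fun I => ?_⟩
  have hrow : ∀ i ∈ I, ∑ j ∈ I, gridCov s e v L L' i j ≤ (L + L' : ℕ) * K := by
    intro i _
    rw [← Finset.sum_filter_of_ne (p := fun j => j ∈ Finset.Ico (i - L') (i + L))]
    · refine (Finset.sum_le_card_nsmul _ _ K fun j _ =>
        (le_abs_self _).trans (gridCov_abs_le s e v L L' i j)).trans ?_
      rw [nsmul_eq_mul]
      gcongr
      calc _ ≤ (Finset.Ico (i - L') (i + L)).card :=
            Finset.card_le_card fun j hj => (Finset.mem_filter.1 hj).2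
        _ ≤ L + L' := by
            rw [Nat.card_Ico]
            omega
    · intro j _ hne
      by_contra hj
      rw [Finset.mem_Ico] at hj
      exact hne (gridCov_eq_zero s e v hL hL' (by omega))
  refine (Finset.sum_le_card_nsmul _ _ _ hrow).trans_eq ?_
  rw [nsmul_eq_mul, mul_comm]

end Kernel

/-! ### Mean-square approximation -/

section Second

variable {Ω : Type*} [MeasurableSpace Ω] {μ : Measure Ω}

/-- Limits of second moments are insensitive to perturbations that vanish in mean square. -/
lemma tendsto_integral_mul_of_sub {U U' A A' : ℕ → Ω → ℝ} {a a' c : ℝ}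
    (hU : ∀ n, MemLp (U n) 2 μ) (hU' : ∀ n, MemLp (U' n) 2 μ)
    (hA : ∀ n, MemLp (A n) 2 μ) (hA' : ∀ n, MemLp (A' n) 2 μ)
    (hUA : Tendsto (fun n => ∫ ω, (U n ω - A n ω) ^ 2 ∂μ) atTop (𝓝 0))
    (hUA' : Tendsto (fun n => ∫ ω, (U' n ω - A' n ω) ^ 2 ∂μ) atTop (𝓝 0))
    (ha : Tendsto (fun n => ∫ ω, A n ω ^ 2 ∂μ) atTop (𝓝 a))
    (ha' : Tendsto (fun n => ∫ ω, A' n ω ^ 2 ∂μ) atTop (𝓝 a'))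
    (hc : Tendsto (fun n => ∫ ω, A n ω * A' n ω ∂μ) atTop (𝓝 c)) :
    Tendsto (fun n => ∫ ω, U n ω * U' n ω ∂μ) atTop (𝓝 c) := by
  have hD : ∀ n, MemLp (fun ω => U n ω - A n ω) 2 μ := fun n => (hU n).sub (hA n)
  have hD' : ∀ n, MemLp (fun ω => U' n ω - A' n ω) 2 μ := fun n => (hU' n).sub (hA' n)
  have hcs : ∀ {X Y : ℕ → Ω → ℝ} {x y : ℝ}, (∀ n, MemLp (X n) 2 μ) → (∀ n, MemLp (Y n) 2 μ) →
      Tendsto (fun n => ∫ ω, X n ω ^ 2 ∂μ) atTop (𝓝 x) →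
      Tendsto (fun n => ∫ ω, Y n ω ^ 2 ∂μ) atTop (𝓝 y) → √x * √y = 0 →
      Tendsto (fun n => ∫ ω, X n ω * Y n ω ∂μ) atTop (𝓝 0) := by
    intro X Y x y hX hY hx hy hxy
    have h := (hx.sqrt).mul (hy.sqrt)
    rw [hxy] at h
    exact squeeze_zero_norm (fun n => abs_integral_mul_le (hX n) (hY n)) h
  have h1 := hcs hA hD' ha hUA' (by simp)
  have h2 := hcs hD hA' hUA ha' (by simp)
  have h3 := hcs hD hD' hUA hUA' (by simp)
  have h := ((hc.add h1).add h2).add h3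
  simp only [add_zero] at h
  refine h.congr fun n => ?_
  have i0 : Integrable (fun ω => A n ω * A' n ω) μ := (hA n).integrable_mul (hA' n)
  have i1 : Integrable (fun ω => A n ω * (U' n ω - A' n ω)) μ := (hA n).integrable_mul (hD' n)
  have i2 : Integrable (fun ω => (U n ω - A n ω) * A' n ω) μ := (hD n).integrable_mul (hA' n)
  have i3 : Integrable (fun ω => (U n ω - A n ω) * (U' n ω - A' n ω)) μ :=
    (hD n).integrable_mul (hD' n)
  have i01 := i0.add i1
  have i012 := i01.add i2
  simp only [Pi.add_def] at i01 i012
  rw [← integral_add i0 i1, ← integral_add i01 i2, ← integral_add i012 i3]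
  congr 1 with ω
  ring

/-- Convergence to zero in mean square implies convergence to zero in probability. -/
lemma tendstoInMeasure_zero_of_integral_sq {D : ℕ → Ω → ℝ} (hD : ∀ n, MemLp (D n) 2 μ)
    (h : Tendsto (fun n => ∫ ω, D n ω ^ 2 ∂μ) atTop (𝓝 0)) :
    TendstoInMeasure μ D atTop (0 : Ω → ℝ) := by
  refine tendstoInMeasure_of_tendsto_eLpNorm (p := 2) (by simp)
    (fun n => (hD n).aestronglyMeasurable) aestronglyMeasurable_zero ?_
  simp only [sub_zero]
  have h1 : ∀ n, eLpNorm (D n) 2 μ = ENNReal.ofReal (√(∫ ω, D n ω ^ 2 ∂μ)) := by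
    intro n
    rw [(hD n).eLpNorm_eq_integral_rpow_norm (by simp) (by simp)]
    simp [Real.sqrt_eq_rpow]
  simp_rw [h1]
  have h2 := ENNReal.tendsto_ofReal h.sqrt
  simpa using h2

end Second

/-! ### Moments of the centered squares -/

section GridModel

variable {Ω : Type*} [MeasurableSpace Ω] {μ : Measure Ω} {β H : ℕ → Ω → ℝ} {s e : ℝ}

/-- The centered square of the price increment starting at `j`, if this one is selected by the
scheme, and zero otherwise. -/
noncomputable def gridSq (β H : ℕ → Ω → ℝ) (s e : ℝ) (v : Scheme) (L j : ℕ) (ω : Ω) : ℝ :=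
  if v.step L ∣ j then gridInc β H L j ω ^ 2 - (s * L + 2 * e) else 0

namespace GridModel

lemma memLp_gridInc_sq (h : GridModel μ β H s e) (L j : ℕ) :
    MemLp (fun ω => gridInc β H L j ω ^ 2) 2 μ := by
  refine (memLp_two_iff_integrable_sq ((h.memLp_gridInc L j (p := 2)
    (by simp)).aestronglyMeasurable.pow 2)).2 ?_
  have h4 := h.memLp_gridInc L j (p := 4) (by simp)
  refine (integrable_mul_four h4 h4 h4 h4).congr (ae_of_all _ fun ω => ?_)
  simp only [Pi.pow_apply]
  ring

lemma memLp_gridSq (h : GridModel μ β H s e) (v : Scheme) (L j : ℕ) :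
    MemLp (gridSq β H s e v L j) 2 μ := by
  have := h.isProbabilityMeasure
  by_cases hd : v.step L ∣ j
  · have h1 : gridSq β H s e v L j = fun ω => gridInc β H L j ω ^ 2 - (s * L + 2 * e) := by
      ext ω
      simp [gridSq, hd]
    rw [h1]
    exact (h.memLp_gridInc_sq L j).sub (memLp_const _)
  · have h1 : gridSq β H s e v L j = 0 := by
      ext ω
      simp [gridSq, hd]
    rw [h1]
    exact MemLp.zero

lemma integral_gridSq (h : GridModel μ β H s e) (v : Scheme) {L : ℕ} (hL : 1 ≤ L) (j : ℕ) :
    ∫ ω, gridSq β H s e v L j ω ∂μ = 0 := by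
  have := h.isProbabilityMeasure
  by_cases hd : v.step L ∣ j
  · simp only [gridSq, hd, if_true]
    rw [integral_sub ((h.memLp_gridInc_sq L j).integrable (by simp)) (integrable_const _),
      h.integral_gridInc_sq hL]
    simp
  · simp [gridSq, hd]

lemma integral_gridSq_mul (h : GridModel μ β H s e) (v : Scheme) {L L' : ℕ} (hL : 1 ≤ L)
    (hL' : 1 ≤ L') (i j : ℕ) :
    ∫ ω, gridSq β H s e v L i ω * gridSq β H s e v L' j ω ∂μ = gridCov s e v L L' i j := by
  have := h.isProbabilityMeasure
  by_cases hd : v.step L ∣ i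
  · by_cases hd' : v.step L' ∣ j
    · simp only [gridSq, hd, hd', if_true, gridCov, and_self]
      have m1 := h.memLp_gridInc_sq L i
      have m2 := h.memLp_gridInc_sq L' j
      have hc := covariance_eq_sub m1 m2
      simp only [Pi.mul_apply] at hc
      rw [h.integral_gridInc_sq_mul_sq hL hL', h.integral_gridInc_sq hL,
        h.integral_gridInc_sq hL'] at hc
      rw [covariance, h.integral_gridInc_sq hL, h.integral_gridInc_sq hL'] at hc
      rw [hc]
      ring
    · simp [gridSq, gridCov, hd']
  · simp [gridSq, gridCov, hd]

lemma integral_sum_gridSq_mul (h : GridModel μ β H s e) (v : Scheme) {L L' : ℕ} (hL : 1 ≤ L)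
    (hL' : 1 ≤ L') (I J : Finset ℕ) :
    ∫ ω, (∑ i ∈ I, gridSq β H s e v L i ω) * (∑ j ∈ J, gridSq β H s e v L' j ω) ∂μ =
      ∑ i ∈ I, ∑ j ∈ J, gridCov s e v L L' i j := by
  have hint : ∀ i j, Integrable (fun ω => gridSq β H s e v L i ω * gridSq β H s e v L' j ω) μ :=
    fun i j => (h.memLp_gridSq v L i).integrable_mul (h.memLp_gridSq v L' j)
  simp_rw [Finset.sum_mul_sum]
  rw [integral_finsetSum _ fun i _ => integrable_finsetSum _ fun j _ => hint i j]
  refine Finset.sum_congr rfl fun i _ => ?_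
  rw [integral_finsetSum _ fun j _ => hint i j]
  exact Finset.sum_congr rfl fun j _ => h.integral_gridSq_mul v hL hL' i j

lemma memLp_sum_gridSq (h : GridModel μ β H s e) (v : Scheme) (L : ℕ) (I : Finset ℕ) :
    MemLp (fun ω => ∑ i ∈ I, gridSq β H s e v L i ω) 2 μ :=
  memLp_finsetSum _ fun i _ => h.memLp_gridSq v L i

lemma exists_integral_sum_gridSq_sq_le (h : GridModel μ β H s e) (v : Scheme) {L : ℕ}
    (hL : 1 ≤ L) :
    ∃ C, 0 ≤ C ∧ ∀ I : Finset ℕ, ∫ ω, (∑ j ∈ I, gridSq β H s e v L j ω) ^ 2 ∂μ ≤ C * I.card := by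
  obtain ⟨C, hC0, hC⟩ := exists_sum_gridCov_le s e v hL hL
  refine ⟨C, hC0, fun I => ?_⟩
  simp_rw [pow_two]
  rw [h.integral_sum_gridSq_mul v hL hL]
  exact hC I

end GridModel

end GridModel

/-! ### The i.i.d. innovations and the central limit theorem -/

section Innovations

variable {Ω : Type*} [MeasurableSpace Ω] {μ : Measure Ω} {β H : ℕ → Ω → ℝ} {s e : ℝ}

/-- The innovation at time `j`: the next increment of the diffusion and the current noise. -/
def innovation (β H : ℕ → Ω → ℝ) (j : ℕ) (ω : Ω) : ℝ × ℝ :=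
  (β (j + 1) ω - β j ω, H j ω)

/-- The price increment over `[r, r + L]` as a function of the innovations. -/
noncomputable def incOf (L r : ℕ) (z : ℕ → ℝ × ℝ) : ℝ :=
  ∑ t ∈ Finset.range L, (z (r + t)).1 + ((z (r + L)).2 - (z r).2)

lemma measurable_incOf (L r : ℕ) : Measurable (incOf L r) := by
  unfold incOf
  fun_prop

/-- The final noise uses coordinate r + L, so the window has L + 1 coordinates and the inequality `r
+ L < P` is strict. -/
lemma incOf_congr {L r P : ℕ} (hr : r + L < P) {z z' : ℕ → ℝ × ℝ} (h : ∀ t < P, z t = z' t) :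
    incOf L r z = incOf L r z' := by
  rw [incOf, incOf, h _ hr, h r (by omega)]
  congr 1
  refine Finset.sum_congr rfl fun t ht => ?_
  rw [Finset.mem_range] at ht
  rw [h _ (by omega)]

lemma gridInc_eq_incOf {Ω : Type*} (β H : ℕ → Ω → ℝ) (L m r : ℕ) (ω : Ω) :
    gridInc β H L (m + r) ω = incOf L r (fun t => innovation β H (m + t) ω) := by
  have h := Finset.sum_range_sub (fun t => β (m + r + t) ω) L
  simp only [gridInc, incOf, innovation, ← add_assoc] at h ⊢
  rw [h, add_zero]

namespace GridModel

lemma indepFun_increment_noise (h : GridModel μ β H s e) :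
    IndepFun (fun ω j => β (j + 1) ω - β j ω) (fun ω j => H j ω) μ :=
  h.indep.comp (φ := fun (x : ℕ → ℝ) (j : ℕ) => x (j + 1) - x j) (ψ := fun x : ℕ → ℝ => x)
    (by fun_prop) measurable_id

lemma iIndepFun_innovation (h : GridModel μ β H s e) : iIndepFun (innovation β H) μ :=
  have := h.isProbabilityMeasure
  iIndepFun_prodMk
    (fun _ => (h.gaussian.aemeasurable _).sub (h.gaussian.aemeasurable _)) h.noise_aemeasurable
    h.increment_indep h.noise_indep h.indepFun_increment_noise

lemma identDistrib_innovation (h : GridModel μ β H s e) (j : ℕ) :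
    IdentDistrib (innovation β H j) (innovation β H 0) μ μ := by
  have := h.isProbabilityMeasure
  have hind : ∀ j, IndepFun (fun ω => β (j + 1) ω - β j ω) (H j) μ := fun j =>
    h.indepFun_increment_noise.comp (φ := fun x : ℕ → ℝ => x j) (ψ := fun x : ℕ → ℝ => x j)
      (by fun_prop) (by fun_prop)
  have hlaw : ∀ j, μ.map (fun ω => β (j + 1) ω - β j ω) = gaussianReal 0 s.toNNReal := by
    intro j
    have hG : HasGaussianLaw (fun ω => β (j + 1) ω - β j ω) μ :=
      h.gaussian.hasGaussianLaw_fun_sub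
    have hv := variance_of_integral_eq_zero hG.aemeasurable (h.integral_diffusion 1 j)
    have h2 := h.integral_diffusion_mul 1 1 j j
    simp only [← pow_two] at h2
    rw [hG.map_eq_gaussianReal, hv, h2, h.integral_diffusion 1 j]
    simp
  have hm : ∀ j, AEMeasurable (fun ω => β (j + 1) ω - β j ω) μ :=
    fun j => (h.gaussian.aemeasurable _).sub (h.gaussian.aemeasurable _)
  exact IdentDistrib.prodMk ⟨hm j, hm 0, by rw [hlaw, hlaw]⟩ (h.noise_ident j) (hind j) (hind 0)

lemma aemeasurable_innovation (h : GridModel μ β H s e) (j : ℕ) :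
    AEMeasurable (innovation β H j) μ :=
  (h.identDistrib_innovation j).aemeasurable_fst

end GridModel

/-- The centered square of the price increment over `[r, r + L]` as a function of the
innovations. -/
noncomputable def sqOf (s e : ℝ) (v : Scheme) (L r : ℕ) (z : ℕ → ℝ × ℝ) : ℝ :=
  if v.step L ∣ r then incOf L r z ^ 2 - (s * L + 2 * e) else 0

lemma measurable_sqOf (s e : ℝ) (v : Scheme) (L r : ℕ) : Measurable (sqOf s e v L r) := by
  have := measurable_incOf L r
  unfold sqOf
  split_ifs <;> fun_prop

lemma sqOf_congr (s e : ℝ) (v : Scheme) {L r P : ℕ} (hr : r + L < P) {z z' : ℕ → ℝ × ℝ}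
    (h : ∀ t < P, z t = z' t) : sqOf s e v L r z = sqOf s e v L r z' := by
  simp only [sqOf, incOf_congr hr h]

lemma gridSq_eq_sqOf {Ω : Type*} (β H : ℕ → Ω → ℝ) (s e : ℝ) (v : Scheme) {L m : ℕ} (hm : v.step L ∣ m) (r : ℕ)
    (ω : Ω) :
    gridSq β H s e v L (m + r) ω = sqOf s e v L r (fun t => innovation β H (m + t) ω) := by
  simp only [gridSq, sqOf, gridInc_eq_incOf, Nat.dvd_add_right hm]

namespace GridModel

/-- Second moments of linear combinations of the sums of centered squares. -/
lemma tendsto_integral_sum_sq (h : GridModel μ β H s e) (v : Scheme) {L L' : ℕ} (hL : 1 ≤ L)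
    (hL' : 1 ≤ L') (a b : ℝ) {c c' d : ℝ}
    (hc : Tendsto (fun n : ℕ => (∑ i ∈ Finset.range n, ∑ j ∈ Finset.range n,
      gridCov s e v L L i j) / n) atTop (𝓝 c))
    (hc' : Tendsto (fun n : ℕ => (∑ i ∈ Finset.range n, ∑ j ∈ Finset.range n,
      gridCov s e v L' L' i j) / n) atTop (𝓝 c'))
    (hd : Tendsto (fun n : ℕ => (∑ i ∈ Finset.range n, ∑ j ∈ Finset.range n,
      gridCov s e v L L' i j) / n) atTop (𝓝 d)) :
    Tendsto (fun n : ℕ => (∫ ω, (∑ j ∈ Finset.range n,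
      (a * gridSq β H s e v L j ω - b * gridSq β H s e v L' j ω)) ^ 2 ∂μ) / n) atTop
      (𝓝 (a ^ 2 * c + b ^ 2 * c' - 2 * a * b * d)) := by
  have h1 := ((hc.const_mul (a ^ 2)).add (hc'.const_mul (b ^ 2))).sub (hd.const_mul (2 * a * b))
  refine h1.congr fun n => ?_
  rw [← h.integral_sum_gridSq_mul v hL hL, ← h.integral_sum_gridSq_mul v hL' hL',
    ← h.integral_sum_gridSq_mul v hL hL']
  set F := fun ω => ∑ j ∈ Finset.range n, gridSq β H s e v L j ω with hF
  set F' := fun ω => ∑ j ∈ Finset.range n, gridSq β H s e v L' j ω with hF'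
  have hFm := h.memLp_sum_gridSq v L (Finset.range n)
  have hFm' := h.memLp_sum_gridSq v L' (Finset.range n)
  have i1 : Integrable (fun ω => F ω * F ω) μ := hFm.integrable_mul hFm
  have i2 : Integrable (fun ω => F' ω * F' ω) μ := hFm'.integrable_mul hFm'
  have i3 : Integrable (fun ω => F ω * F' ω) μ := hFm.integrable_mul hFm'
  have hexp : ∀ ω, (∑ j ∈ Finset.range n,
      (a * gridSq β H s e v L j ω - b * gridSq β H s e v L' j ω)) ^ 2 =
      a ^ 2 * (F ω * F ω) + b ^ 2 * (F' ω * F' ω) - 2 * a * b * (F ω * F' ω) := fun ω => by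
    rw [Finset.sum_sub_distrib, ← Finset.mul_sum, ← Finset.mul_sum]
    ring
  simp_rw [hexp]
  rw [integral_sub (by fun_prop) (by fun_prop), integral_add (by fun_prop) (by fun_prop),
    integral_const_mul, integral_const_mul, integral_const_mul]
  ring

/-- The central limit theorem for linear combinations of the sums of centered squares. -/
theorem tendstoInDistribution_sum (h : GridModel μ β H s e) [IsProbabilityMeasure μ] (v : Scheme)
    {L L' : ℕ} (hL : 1 ≤ L) (hL' : 1 ≤ L') (a b : ℝ) {γ : ℝ}
    (hγ : Tendsto (fun n : ℕ => (∫ ω, (∑ j ∈ Finset.range n,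
      (a * gridSq β H s e v L j ω - b * gridSq β H s e v L' j ω)) ^ 2 ∂μ) / n) atTop (𝓝 γ)) :
    TendstoInDistribution (fun (n : ℕ) ω => (√n)⁻¹ * ∑ j ∈ Finset.range n,
        (a * gridSq β H s e v L j ω - b * gridSq β H s e v L' j ω)) atTop
      (id : ℝ → ℝ) (fun _ => μ) (gaussianReal 0 γ.toNNReal) := by
  obtain ⟨C, -, hC⟩ := h.exists_integral_sum_gridSq_sq_le v hL
  obtain ⟨C', -, hC'⟩ := h.exists_integral_sum_gridSq_sq_le v hL'
  -- Block starts are multiples of both steps, so every block sees the same pattern of selected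
  -- indices.
  set T := v.step L * v.step L' with hTdef
  have hT : 0 < T := Nat.mul_pos (v.step_pos hL) (v.step_pos hL')
  set M := max L L' with hM
  let G : ℕ → (ℕ → ℝ × ℝ) → ℝ := fun N z => ∑ r ∈ Finset.range ((N + 1) * T - M),
    (a * sqOf s e v L r z - b * sqOf s e v L' r z)
  have hGm : ∀ N, Measurable (G N) := fun N => by
    have h1 := measurable_sqOf s e v L
    have h2 := measurable_sqOf s e v L'
    exact Finset.measurable_fun_sum _ fun r _ => ((h1 r).const_mul a).sub ((h2 r).const_mul b)
  have hGP : ∀ N z z', (∀ r < (N + 1) * T, z r = z' r) → G N z = G N z' := by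
    intro N z z' hz
    refine Finset.sum_congr rfl fun r hr => ?_
    rw [Finset.mem_range] at hr
    rw [sqOf_congr s e v (by omega) hz, sqOf_congr s e v (by omega) hz]
  have hG : ∀ N q ω, ∑ r ∈ Finset.range ((N + 1) * T - M),
      (a * gridSq β H s e v L (q * ((N + 1) * T) + r) ω -
        b * gridSq β H s e v L' (q * ((N + 1) * T) + r) ω) =
      G N (fun r => innovation β H (q * ((N + 1) * T) + r) ω) := by
    intro N q ω
    refine Finset.sum_congr rfl fun r _ => ?_
    have hd : T ∣ q * ((N + 1) * T) := ⟨q * (N + 1), by ring⟩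
    rw [gridSq_eq_sqOf β H s e v ((Dvd.intro _ rfl).trans hd),
      gridSq_eq_sqOf β H s e v ((Dvd.intro_left _ rfl).trans hd)]
  -- The constant comes from (x + y)² ≤ 2x² + 2y².
  refine tendstoInDistribution_of_block (C := 2 * a ^ 2 * C + 2 * b ^ 2 * C') (M := M) hT
    (fun j => ((h.memLp_gridSq v L j).const_mul a).sub ((h.memLp_gridSq v L' j).const_mul b))
    (fun j => ?_) (fun I => ?_) hγ (fun N => ?_) (fun N q => ?_)
  · rw [integral_sub (((h.memLp_gridSq v L j).const_mul a).integrable (by simp))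
      (((h.memLp_gridSq v L' j).const_mul b).integrable (by simp)), integral_const_mul,
      integral_const_mul, h.integral_gridSq v hL, h.integral_gridSq v hL']
    simp
  · have hm := h.memLp_sum_gridSq v L I
    have hm' := h.memLp_sum_gridSq v L' I
    have h1 := integral_add_sq_le (hm.const_mul a) (hm'.const_mul (-b))
    simp only [mul_pow, integral_const_mul] at h1
    calc _ = ∫ ω, (a * ∑ i ∈ I, gridSq β H s e v L i ω +
          -b * ∑ i ∈ I, gridSq β H s e v L' i ω) ^ 2 ∂μ := by
            congr 1 with ω
            rw [Finset.sum_sub_distrib, ← Finset.mul_sum, ← Finset.mul_sum]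
            ring
      _ ≤ _ := h1
      _ ≤ 2 * (a ^ 2 * (C * I.card)) + 2 * ((-b) ^ 2 * (C' * I.card)) := by
            gcongr
            · exact hC I
            · exact hC' I
      _ = _ := by ring
  · simp_rw [hG]
    exact iIndepFun_block h.aemeasurable_innovation h.iIndepFun_innovation (by positivity) (hGm N)
      (hGP N)
  · simp_rw [hG]
    have h1 := fun m => identDistrib_shift h.iIndepFun_innovation h.identDistrib_innovation
      (hGm N) m
    exact (h1 _).trans (h1 _).symm

end GridModel

end Innovations

/-! ### Asymptotics of the empirical variances -/

section Estimator

/-- The empirical variance of the increments of duration `L` selected by the scheme. -/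
noncomputable def gridVar {Ω : Type*} (β H : ℕ → Ω → ℝ) (v : Scheme) (n L : ℕ) (ω : Ω) : ℝ :=
  1 / (v.count n L : ℝ) * ∑ i ∈ Finset.range (v.count n L), gridInc β H L (i * v.step L) ω ^ 2

/-- The normalized error of the empirical variance. -/
noncomputable def gridErr {Ω : Type*} (β H : ℕ → Ω → ℝ) (s e : ℝ) (v : Scheme) (L n : ℕ) (ω : Ω) :
    ℝ :=
  √n * (gridVar β H v n L ω - (s * L + 2 * e))

/-- The sum of centered squares approximating the normalized error of the empirical variance. -/
noncomputable def gridSum {Ω : Type*} (β H : ℕ → Ω → ℝ) (s e : ℝ) (v : Scheme) (L n : ℕ) (ω : Ω) :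
    ℝ :=
  v.step L * ((√n)⁻¹ * ∑ j ∈ Finset.range n, gridSq β H s e v L j ω)

lemma gridVar_sub {Ω : Type*} (β H : ℕ → Ω → ℝ) (s e : ℝ) (v : Scheme) {L n : ℕ} (hL : 1 ≤ L)
    (hn : L < n) (ω : Ω) :
    gridVar β H v n L ω - (s * L + 2 * e) =
      (v.count n L : ℝ)⁻¹ * ∑ j ∈ Finset.range (n - L), gridSq β H s e v L j ω := by
  have hk : (v.count n L : ℝ) ≠ 0 := by exact_mod_cast (v.count_pos hL hn).ne'
  have h1 := v.sum_count hL n (fun j => gridInc β H L j ω ^ 2 - (s * L + 2 * e))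
  simp only [gridSq]
  rw [← h1, Finset.sum_sub_distrib, gridVar]
  simp only [Finset.sum_const, Finset.card_range, nsmul_eq_mul]
  field_simp

variable {Ω : Type*} [MeasurableSpace Ω] {μ : Measure Ω} {β H : ℕ → Ω → ℝ} {s e : ℝ}

namespace GridModel

lemma memLp_gridVar (h : GridModel μ β H s e) (v : Scheme) (n L : ℕ) :
    MemLp (gridVar β H v n L) 2 μ :=
  (memLp_finsetSum _ fun _ _ => h.memLp_gridInc_sq L _).const_mul _

lemma integral_gridVar (h : GridModel μ β H s e) (v : Scheme) {n L : ℕ} (hL : 1 ≤ L) (hn : L < n) :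
    ∫ ω, gridVar β H v n L ω ∂μ = s * L + 2 * e := by
  have hk : (v.count n L : ℝ) ≠ 0 := by exact_mod_cast (v.count_pos hL hn).ne'
  have := h.isProbabilityMeasure
  simp only [gridVar]
  rw [integral_const_mul, integral_finsetSum _ fun i _ =>
    (h.memLp_gridInc_sq L (i * v.step L)).integrable (by simp)]
  simp only [h.integral_gridInc_sq hL, Finset.sum_const, Finset.card_range, nsmul_eq_mul]
  field_simp

lemma memLp_gridErr (h : GridModel μ β H s e) (v : Scheme) (L n : ℕ) :
    MemLp (gridErr β H s e v L n) 2 μ := by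
  have := h.isProbabilityMeasure
  exact ((h.memLp_gridVar v n L).sub (memLp_const _)).const_mul _

lemma memLp_gridSum (h : GridModel μ β H s e) (v : Scheme) (L n : ℕ) :
    MemLp (gridSum β H s e v L n) 2 μ :=
  ((h.memLp_sum_gridSq v L _).const_mul _).const_mul _

/-- The normalized error of the empirical variance is approximated in mean square by a sum. -/
lemma tendsto_integral_gridErr_sub_gridSum (h : GridModel μ β H s e) (v : Scheme) {L : ℕ}
    (hL : 1 ≤ L) :
    Tendsto (fun n => ∫ ω, (gridErr β H s e v L n ω - gridSum β H s e v L n ω) ^ 2 ∂μ) atTop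
      (𝓝 0) := by
  obtain ⟨C, hC0, hC⟩ := h.exists_integral_sum_gridSq_sq_le v hL
  have hs : (0 : ℝ) < v.step L := by exact_mod_cast v.step_pos hL
  -- Two errors: the count is only asymptotically n/step, and `gridSum` includes the last L indices,
  -- whose increments would leave the observation window.
  have hlim : Tendsto (fun n : ℕ => 2 * C * ((n : ℝ) / v.count n L - v.step L) ^ 2 +
      2 * (v.step L : ℝ) ^ 2 * C * L / n) atTop (𝓝 0) := by
    have h1 := ((v.tendsto_count_div hL).inv₀ (inv_ne_zero hs.ne')).sub_const (v.step L : ℝ)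
    simp only [inv_inv, inv_div, sub_self] at h1
    have h2 := (h1.pow 2).const_mul (2 * C)
    have h3 := tendsto_const_div_atTop_nhds_zero_nat (2 * (v.step L : ℝ) ^ 2 * C * L)
    simpa using h2.add h3
  refine squeeze_zero' (Eventually.of_forall fun n => integral_nonneg fun ω => sq_nonneg _) ?_ hlim
  filter_upwards [eventually_gt_atTop L] with n hn
  have hk : (0 : ℝ) < v.count n L := by exact_mod_cast v.count_pos hL hn
  have hn0 : (0 : ℝ) < n := by exact_mod_cast (by omega : 0 < n)
  have hsq : (√(n : ℝ)) ^ 2 = n := Real.sq_sqrt hn0.le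
  have hsq0 : 0 < √(n : ℝ) := Real.sqrt_pos.2 hn0
  have hm1 := h.memLp_sum_gridSq v L (Finset.range (n - L))
  have hm2 := h.memLp_sum_gridSq v L (Finset.Ico (n - L) n)
  have h1 := integral_add_sq_le (hm1.const_mul (√n * (v.count n L : ℝ)⁻¹ - v.step L * (√n)⁻¹))
    (hm2.const_mul (-(v.step L * (√n)⁻¹)))
  simp only [mul_pow, integral_const_mul] at h1
  calc _ = ∫ ω, ((√n * (v.count n L : ℝ)⁻¹ - v.step L * (√n)⁻¹) *
          ∑ j ∈ Finset.range (n - L), gridSq β H s e v L j ω + -(v.step L * (√n)⁻¹) *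
          ∑ j ∈ Finset.Ico (n - L) n, gridSq β H s e v L j ω) ^ 2 ∂μ := by
        congr 1 with ω
        rw [gridErr, gridVar_sub β H s e v hL hn, gridSum,
          ← Finset.sum_range_add_sum_Ico _ (Nat.sub_le n L)]
        ring
    _ ≤ _ := h1
    _ ≤ 2 * ((√n * (v.count n L : ℝ)⁻¹ - v.step L * (√n)⁻¹) ^ 2 * (C * n)) +
        2 * ((-(v.step L * (√n)⁻¹)) ^ 2 * (C * L)) := by
        gcongr
        · refine (hC _).trans ?_
          rw [Finset.card_range]
          gcongr
          omega
        · refine (hC _).trans ?_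
          rw [Nat.card_Ico]
          gcongr
          omega
    _ = _ := by
        have e1 : (√n * (v.count n L : ℝ)⁻¹ - v.step L * (√n)⁻¹) ^ 2 * n =
            ((n : ℝ) / v.count n L - v.step L) ^ 2 := by
          nth_rewrite 3 [← hsq]
          rw [← mul_pow]
          congr 1
          field_simp
          rw [hsq]
        have e2 : ((√(n : ℝ))⁻¹) ^ 2 = (n : ℝ)⁻¹ := by rw [inv_pow, hsq]
        have e3 : (-(v.step L * (√(n : ℝ))⁻¹)) ^ 2 = (v.step L : ℝ) ^ 2 * (n : ℝ)⁻¹ := by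
          rw [neg_sq, mul_pow, e2]
        rw [e3, ← e1]
        ring

lemma tendsto_integral_gridSum_mul (h : GridModel μ β H s e) (v : Scheme) {L L' : ℕ} (hL : 1 ≤ L)
    (hL' : 1 ≤ L') {c : ℝ}
    (hc : Tendsto (fun n : ℕ => (∑ i ∈ Finset.range n, ∑ j ∈ Finset.range n,
      gridCov s e v L L' i j) / n) atTop (𝓝 c)) :
    Tendsto (fun n => ∫ ω, gridSum β H s e v L n ω * gridSum β H s e v L' n ω ∂μ) atTop
      (𝓝 (v.step L * v.step L' * c)) := by
  refine (hc.const_mul (v.step L * v.step L' : ℝ)).congr fun n => ?_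
  have hsq : (√(n : ℝ))⁻¹ * (√(n : ℝ))⁻¹ = (n : ℝ)⁻¹ := by
    rw [← mul_inv, Real.mul_self_sqrt (by positivity)]
  rw [← h.integral_sum_gridSq_mul v hL hL', div_eq_mul_inv, ← hsq, ← integral_mul_const,
    ← integral_const_mul]
  congr 1 with ω
  simp only [gridSum]
  ring

/-- The mixed moments of the sums pass to the errors because the two are asymptotically equal in L².
This yields the limit of n times the covariance of the empirical variances. -/
lemma tendsto_integral_gridErr_mul (h : GridModel μ β H s e) (v : Scheme) {L L' : ℕ} (hL : 1 ≤ L)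
    (hL' : 1 ≤ L') {c : ℝ}
    (hc : Tendsto (fun n : ℕ => (∑ i ∈ Finset.range n, ∑ j ∈ Finset.range n,
      gridCov s e v L L' i j) / n) atTop (𝓝 c)) :
    Tendsto (fun n => ∫ ω, gridErr β H s e v L n ω * gridErr β H s e v L' n ω ∂μ) atTop
      (𝓝 (v.step L * v.step L' * c)) := by
  obtain ⟨d, hd⟩ := exists_tendsto_gridCov s e v hL hL
  obtain ⟨d', hd'⟩ := exists_tendsto_gridCov s e v hL' hL'
  have h1 := h.tendsto_integral_gridSum_mul v hL hL hd
  have h2 := h.tendsto_integral_gridSum_mul v hL' hL' hd'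
  simp only [← pow_two (gridSum _ _ _ _ _ _ _ _)] at h1 h2
  exact tendsto_integral_mul_of_sub (h.memLp_gridErr v L) (h.memLp_gridErr v L')
    (h.memLp_gridSum v L) (h.memLp_gridSum v L') (h.tendsto_integral_gridErr_sub_gridSum v hL)
    (h.tendsto_integral_gridErr_sub_gridSum v hL') h1 h2 (h.tendsto_integral_gridSum_mul v hL hL' hc)

lemma integral_gridErr_mul (h : GridModel μ β H s e) (v : Scheme) {n L L' : ℕ} (hL : 1 ≤ L)
    (hL' : 1 ≤ L') (hn : L < n) (hn' : L' < n) :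
    ∫ ω, gridErr β H s e v L n ω * gridErr β H s e v L' n ω ∂μ =
      n * cov[gridVar β H v n L, gridVar β H v n L'; μ] := by
  rw [covariance, h.integral_gridVar v hL hn, h.integral_gridVar v hL' hn', ← integral_const_mul]
  congr 1 with ω
  have hsq : √(n : ℝ) * √(n : ℝ) = n := Real.mul_self_sqrt (Nat.cast_nonneg n)
  rw [gridErr, gridErr, mul_mul_mul_comm, hsq]

/-- The correlation of the empirical variances converges. -/
lemma tendsto_corr_gridVar (h : GridModel μ β H s e) (v : Scheme) {L L' : ℕ} (hL : 1 ≤ L)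
    (hL' : 1 ≤ L') {c c' d : ℝ} (hcpos : 0 < c) (hcpos' : 0 < c')
    (hc : Tendsto (fun n : ℕ => (∑ i ∈ Finset.range n, ∑ j ∈ Finset.range n,
      gridCov s e v L L i j) / n) atTop (𝓝 c))
    (hc' : Tendsto (fun n : ℕ => (∑ i ∈ Finset.range n, ∑ j ∈ Finset.range n,
      gridCov s e v L' L' i j) / n) atTop (𝓝 c'))
    (hd : Tendsto (fun n : ℕ => (∑ i ∈ Finset.range n, ∑ j ∈ Finset.range n,
      gridCov s e v L L' i j) / n) atTop (𝓝 d)) :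
    Tendsto (fun n => corr μ (gridVar β H v n L) (gridVar β H v n L')) atTop
      (𝓝 (v.step L * v.step L' * d /
        (√(v.step L * v.step L * c) * √(v.step L' * v.step L' * c')))) := by
  have hs : (0 : ℝ) < v.step L := by exact_mod_cast v.step_pos hL
  have hs' : (0 : ℝ) < v.step L' := by exact_mod_cast v.step_pos hL'
  have h1 := h.tendsto_integral_gridErr_mul v hL hL hc
  have h2 := h.tendsto_integral_gridErr_mul v hL' hL' hc'
  have h3 := h.tendsto_integral_gridErr_mul v hL hL' hd
  refine (h3.div (h1.sqrt.mul h2.sqrt) (by positivity)).congr' ?_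
  filter_upwards [eventually_gt_atTop L, eventually_gt_atTop L'] with n hn hn'
  have hn0 : (0 : ℝ) < n := by exact_mod_cast (by omega : 0 < n)
  simp only [Pi.div_apply]
  rw [h.integral_gridErr_mul v hL hL hn hn, h.integral_gridErr_mul v hL' hL' hn' hn',
    h.integral_gridErr_mul v hL hL' hn hn', corr,
    covariance_self (h.memLp_gridVar v n L).aestronglyMeasurable.aemeasurable,
    covariance_self (h.memLp_gridVar v n L').aestronglyMeasurable.aemeasurable,
    Real.sqrt_mul hn0.le, Real.sqrt_mul hn0.le]
  have hsq : √(n : ℝ) * √(n : ℝ) = n := Real.mul_self_sqrt hn0.le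
  rw [mul_mul_mul_comm, hsq, mul_div_mul_left _ _ hn0.ne']

/-- Asymptotic normality of linear combinations of two empirical variances. -/
lemma tendstoInDistribution_gridErr (h : GridModel μ β H s e) [IsProbabilityMeasure μ] (v : Scheme)
    {L L' : ℕ} (hL : 1 ≤ L) (hL' : 1 ≤ L') (a b : ℝ) {c c' d : ℝ}
    (hc : Tendsto (fun n : ℕ => (∑ i ∈ Finset.range n, ∑ j ∈ Finset.range n,
      gridCov s e v L L i j) / n) atTop (𝓝 c))
    (hc' : Tendsto (fun n : ℕ => (∑ i ∈ Finset.range n, ∑ j ∈ Finset.range n,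
      gridCov s e v L' L' i j) / n) atTop (𝓝 c'))
    (hd : Tendsto (fun n : ℕ => (∑ i ∈ Finset.range n, ∑ j ∈ Finset.range n,
      gridCov s e v L L' i j) / n) atTop (𝓝 d)) {γ : ℝ}
    (hγ : γ = (a * v.step L) ^ 2 * c + (b * v.step L') ^ 2 * c'
      - 2 * (a * v.step L) * (b * v.step L') * d) :
    0 ≤ γ ∧ TendstoInDistribution
      (fun n ω => a * gridErr β H s e v L n ω - b * gridErr β H s e v L' n ω) atTop
      (id : ℝ → ℝ) (fun _ => μ) (gaussianReal 0 γ.toNNReal) := by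
  have hlim := h.tendsto_integral_sum_sq v hL hL' (a * v.step L) (b * v.step L') hc hc' hd
  rw [← hγ] at hlim
  refine ⟨ge_of_tendsto' hlim fun n => by positivity, ?_⟩
  have hclt := h.tendstoInDistribution_sum v hL hL' (a * v.step L) (b * v.step L') hlim
  have hU : ∀ n, MemLp (fun ω => a * gridErr β H s e v L n ω - b * gridErr β H s e v L' n ω) 2 μ :=
    fun n => ((h.memLp_gridErr v L n).const_mul a).sub ((h.memLp_gridErr v L' n).const_mul b)
  have hA : ∀ n : ℕ, (fun ω => (√n)⁻¹ * ∑ j ∈ Finset.range n,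
      (a * v.step L * gridSq β H s e v L j ω - b * v.step L' * gridSq β H s e v L' j ω)) =
      fun ω => a * gridSum β H s e v L n ω - b * gridSum β H s e v L' n ω := by
    intro n
    ext ω
    rw [Finset.sum_sub_distrib, ← Finset.mul_sum, ← Finset.mul_sum, gridSum, gridSum]
    ring
  rw [funext hA] at hclt
  -- Slutsky: the error and the sum differ by a term that vanishes in mean square, hence in
  -- probability.
  refine tendstoInDistribution_of_tendstoInMeasure_sub _ _ hclt ?_
    fun n => (hU n).aestronglyMeasurable.aemeasurable
  have hD : ∀ L n, MemLp (fun ω => gridErr β H s e v L n ω - gridSum β H s e v L n ω) 2 μ :=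
    fun L n => (h.memLp_gridErr v L n).sub (h.memLp_gridSum v L n)
  refine tendstoInMeasure_zero_of_integral_sq
    (fun n => (hU n).sub (((h.memLp_gridSum v L n).const_mul a).sub
      ((h.memLp_gridSum v L' n).const_mul b))) ?_
  have hb := ((h.tendsto_integral_gridErr_sub_gridSum v hL).const_mul (2 * a ^ 2)).add
    ((h.tendsto_integral_gridErr_sub_gridSum v hL').const_mul (2 * (-b) ^ 2))
  simp only [mul_zero, add_zero] at hb
  refine squeeze_zero (fun n => integral_nonneg fun ω => sq_nonneg _) (fun n => ?_) hb
  have h1 := integral_add_sq_le ((hD L n).const_mul a) ((hD L' n).const_mul (-b))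
  simp only [mul_pow, integral_const_mul, ← mul_assoc] at h1
  refine le_trans (le_of_eq ?_) h1
  congr 1 with ω
  simp only [Pi.sub_apply]
  ring

/-- The empirical variances are consistent in mean square. -/
lemma tendsto_integral_gridVar_sub_sq (h : GridModel μ β H s e) (v : Scheme) {L : ℕ} (hL : 1 ≤ L) :
    Tendsto (fun n => ∫ ω, (gridVar β H v n L ω - (s * L + 2 * e)) ^ 2 ∂μ) atTop (𝓝 0) := by
  obtain ⟨c, hc⟩ := exists_tendsto_gridCov s e v hL hL
  have h1 := (h.tendsto_integral_gridErr_mul v hL hL hc).mul tendsto_inv_atTop_nhds_zero_nat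
  rw [mul_zero] at h1
  refine h1.congr' ?_
  filter_upwards [eventually_gt_atTop 0] with n hn
  have hn0 : (0 : ℝ) < n := by exact_mod_cast hn
  rw [← integral_mul_const]
  congr 1 with ω
  have hsq : √(n : ℝ) * √(n : ℝ) = n := Real.mul_self_sqrt hn0.le
  rw [gridErr, mul_mul_mul_comm, hsq]
  field_simp

/-- For strictly disjoint increments the empirical variances are strongly consistent. -/
lemma ae_tendsto_gridVar_disjoint (h : GridModel μ β H s e) {L : ℕ} (hL : 1 ≤ L) :
    ∀ᵐ ω ∂μ, Tendsto (fun n => gridVar β H .disjoint n L ω) atTop (𝓝 (s * L + 2 * e)) := by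
  let G : (ℕ → ℝ × ℝ) → ℝ := fun z => incOf L 0 z ^ 2
  have hGm : Measurable G := (measurable_incOf L 0).pow_const 2
  have hG : ∀ q ω, gridInc β H L (q * (L + 1)) ω ^ 2 =
      G (fun r => innovation β H (q * (L + 1) + r) ω) := fun q ω => by
    rw [← add_zero (q * (L + 1)), gridInc_eq_incOf]
    simp [G]
  -- Each increment uses exactly one block of L + 1 innovations. With step L, consecutive increments
  -- would share an endpoint noise.
  have hind : iIndepFun (fun q ω => gridInc β H L (q * (L + 1)) ω ^ 2) μ := by
    simp_rw [hG]
    refine iIndepFun_block h.aemeasurable_innovation h.iIndepFun_innovation (by omega) hGm ?_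
    intro z z' hz
    simp only [G]
    rw [incOf_congr (by omega) hz]
  have hid : ∀ q, IdentDistrib (fun ω => gridInc β H L (q * (L + 1)) ω ^ 2)
      (fun ω => gridInc β H L (0 * (L + 1)) ω ^ 2) μ μ := by
    simp_rw [hG]
    have h1 := fun m => identDistrib_shift h.iIndepFun_innovation h.identDistrib_innovation hGm m
    exact fun q => (h1 _).trans (h1 _).symm
  have := h.isProbabilityMeasure
  have hlln := strong_law_ae_real (fun q ω => gridInc β H L (q * (L + 1)) ω ^ 2)
    ((h.memLp_gridInc_sq L _).integrable (by simp)) (fun i j hij => hind.indepFun hij) hid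
  rw [h.integral_gridInc_sq hL] at hlln
  have hcount : Tendsto (fun n => Scheme.disjoint.count n L) atTop atTop :=
    Nat.tendsto_div_const_atTop (by omega)
  filter_upwards [hlln] with ω hω
  refine (hω.comp hcount).congr fun n => ?_
  simp only [Function.comp, gridVar, Scheme.step]
  ring

end GridModel

end Estimator

/-! ### From the market model to the grid -/

section Market

variable {Ω : Type*} [MeasurableSpace Ω] {μ : Measure Ω} {pStar X : ℝ≥0 → Ω → ℝ} {σ S : ℝ}

/-- The displacement of the mid price, observed on the grid of mesh `τ`. -/
def midGrid {Ω : Type*} (pStar : ℝ≥0 → Ω → ℝ) (τ : ℝ≥0) (j : ℕ) (ω : Ω) : ℝ :=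
  pStar (j * τ) ω - pStar 0 ω

/-- The noise, observed on the grid of mesh `τ`. -/
noncomputable def noiseGrid {Ω : Type*} (S : ℝ) (X : ℝ≥0 → Ω → ℝ) (τ : ℝ≥0) (j : ℕ) (ω : Ω) : ℝ :=
  noise S X (j * τ) ω

lemma logPrice_sub {Ω : Type*} (S : ℝ) (pStar X : ℝ≥0 → Ω → ℝ) (τ : ℝ≥0) (L j : ℕ) (ω : Ω) :
    logPrice S pStar X ((j + L : ℕ) * τ) ω - logPrice S pStar X (j * τ) ω =
      gridInc (midGrid pStar τ) (noiseGrid S X τ) L j ω := by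
  simp only [logPrice, gridInc, midGrid, noiseGrid]
  ring

lemma empVar_logPrice {Ω : Type*} (S : ℝ) (pStar X : ℝ≥0 → Ω → ℝ) (τ : ℝ≥0) (v : Scheme)
    (n L : ℕ) :
    empVar (logPrice S pStar X) τ v n L =
      gridVar (midGrid pStar τ) (noiseGrid S X τ) v n L := by
  ext ω
  simp only [empVar, gridVar, logPrice_sub, Scheme.start_eq]

lemma integral_noise_eq_zero {t : ℝ≥0} (hX : HasLaw (X t) bernoulliHalf μ) :
    ∫ ω, noise S X t ω ∂μ = 0 := by
  have h := hX.integral_comp (f := fun x => S * (x - 1 / 2)) (by fun_prop)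
  simp only [bernoulliHalf] at h
  rw [integral_bernoulliMeasure] at h
  refine h.trans ?_
  norm_num

lemma noise_sq_ae_eq {t : ℝ≥0} (hX : HasLaw (X t) bernoulliHalf μ) :
    ∀ᵐ ω ∂μ, noise S X t ω ^ 2 = S ^ 2 / 4 := by
  have h : ∀ᵐ x ∂bernoulliHalf, (S * (x - 1 / 2)) ^ 2 = S ^ 2 / 4 := by
    rw [bernoulliHalf, bernoulliMeasure_def, ae_add_measure_iff]
    constructor
    · refine Measure.ae_smul_measure ?_ _
      rw [ae_dirac_eq]
      simp only [eventually_pure]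
      ring
    · refine Measure.ae_smul_measure ?_ _
      rw [ae_dirac_eq]
      simp only [eventually_pure]
      ring
  rw [← hX.map_eq] at h
  exact ae_of_ae_map hX.aemeasurable h

/-- Subtracting the arbitrary initial value leaves σ times a standard Brownian motion. Positivity of
τ makes the sampling times distinct, so the sampled noises remain independent. -/
lemma MarketModel.gridModel (h : MarketModel μ pStar X σ S) (hσ : 0 < σ) {τ : ℝ≥0} (hτ : 0 < τ) :
    GridModel μ (midGrid pStar τ) (noiseGrid S X τ) (σ ^ 2 * τ) (S ^ 2 / 4) := by
  set b : ℝ≥0 → Ω → ℝ := fun t ω => (pStar t ω - pStar 0 ω) / σ with hb_def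
  have hb : IsPreBrownianReal b μ := h.brownian.isBrownianReal.toIsPreBrownianReal
  have hmid : midGrid pStar τ = fun (j : ℕ) ω => σ * b (j * τ) ω := by
    ext j ω
    simp only [midGrid, b]
    field_simp
  have hmono : Monotone fun j : ℕ => (j : ℝ≥0) * τ := fun i j hij => by
    simp only
    gcongr
  have hinj : Function.Injective fun j : ℕ => (j : ℝ≥0) * τ := fun i j hij => by
    simpa [hτ.ne'] using hij
  have hX := h.direction_law
  have hlaw : ∀ t, HasLaw (noise S X t) (bernoulliHalf.map fun x => S * (x - 1 / 2)) μ := by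
    intro t
    have hm : Measurable fun x : ℝ => S * (x - 1 / 2) := by fun_prop
    refine ⟨hm.comp_aemeasurable (hX t).aemeasurable, ?_⟩
    rw [← (hX t).map_eq, AEMeasurable.map_map_of_aemeasurable hm.aemeasurable (hX t).aemeasurable]
    rfl
  refine ⟨?_, ?_, ?_, ?_, ?_, ?_, ?_, ?_, ?_, ?_⟩
  · rw [hmid]
    exact (hb.isGaussianProcess.comp_right fun j : ℕ => (j : ℝ≥0) * τ).smul fun _ => σ
  · intro j
    rw [hmid]
    simp only [integral_const_mul]
    rw [hb.integral_eval, mul_zero]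
  · intro i j
    rw [hmid]
    simp only
    rw [covariance_const_mul_left, covariance_const_mul_right, hb.covariance_fun_eval]
    have h1 : min ((i : ℝ≥0) * τ) (j * τ) = (min i j : ℕ) * τ :=
      (hmono.map_min (a := i) (b := j)).symm
    rw [h1]
    push_cast
    ring
  · exact fun j => (hlaw _).aemeasurable
  · exact fun j => ⟨(hlaw _).aemeasurable, (hlaw _).aemeasurable,
      (hlaw _).map_eq.trans (hlaw _).map_eq.symm⟩
  · exact iIndepFun.precomp (g := fun j : ℕ => (j : ℝ≥0) * τ) hinj h.noise_indep
  · exact fun j => integral_noise_eq_zero (hX _)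
  · exact fun j => noise_sq_ae_eq (hX _)
  · have h1 := (hb.hasIndepIncrements.nat hmono).comp (fun _ x => σ * x)
      (fun _ => by fun_prop)
    rw [hmid]
    convert h1 using 2 with j
    ext ω
    simp only [Function.comp]
    ring
  · exact h.mid_indep_noise.comp
      (φ := fun (x : ℝ≥0 → ℝ) (j : ℕ) => x (j * τ) - x 0)
      (ψ := fun (x : ℝ≥0 → ℝ) (j : ℕ) => x (j * τ)) (by fun_prop) (by fun_prop)

lemma sigmaSq_pos (hσ : 0 < σ) {τ : ℝ≥0} (hτ : 0 < τ) (v : Scheme) {L : ℕ} (hL : 1 ≤ L) :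
    0 < sigmaSq σ S τ v L := by
  have hL0 : (0 : ℝ) < L := by exact_mod_cast hL
  have hτ0 : (0 : ℝ) < τ := by exact_mod_cast hτ
  cases v <;> simp only [sigmaSq] <;> positivity

lemma incrementVar_logPrice {τ : ℝ≥0}
    (h : GridModel μ (midGrid pStar τ) (noiseGrid S X τ) (σ ^ 2 * τ) (S ^ 2 / 4)) {L : ℕ}
    (hL : 1 ≤ L) :
    incrementVar (logPrice S pStar X) μ (L * τ) = σ ^ 2 * τ * L + S ^ 2 / 2 := by
  have h1 : (fun ω => logPrice S pStar X (L * τ) ω - logPrice S pStar X 0 ω) =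
      gridInc (midGrid pStar τ) (noiseGrid S X τ) L 0 := by
    ext ω
    rw [← logPrice_sub]
    simp
  rw [incrementVar, h1, variance_of_integral_eq_zero
    (h.memLp_gridInc L 0 (p := 2) (by simp)).aestronglyMeasurable.aemeasurable
    (h.integral_gridInc L 0), h.integral_gridInc_sq hL]
  ring

/-- With δ = u both increments coincide, so K is a fourth moment and K - V² is the variance of a
squared increment, namely the `sigmaSq` of the disjoint scheme. -/
lemma incrementMoment_logPrice {τ : ℝ≥0}
    (h : GridModel μ (midGrid pStar τ) (noiseGrid S X τ) (σ ^ 2 * τ) (S ^ 2 / 4)) {L : ℕ}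
    (hL : 1 ≤ L) :
    incrementMoment (logPrice S pStar X) μ (L * τ) (L * τ) =
      (σ ^ 2 * τ * L + S ^ 2 / 2) ^ 2 + sigmaSq σ S τ .disjoint L := by
  have h1 : ∀ ω, logPrice S pStar X (L * τ) ω - logPrice S pStar X 0 ω =
      gridInc (midGrid pStar τ) (noiseGrid S X τ) L 0 ω := by
    intro ω
    rw [← logPrice_sub]
    simp
  have e1 : Real.toNNReal (2 * ((L * τ : ℝ≥0) : ℝ) - L * τ) = L * τ := by
    have h2 : 2 * ((L * τ : ℝ≥0) : ℝ) - L * τ = (L * τ : ℝ≥0) := by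
      push_cast
      ring
    rw [h2, Real.toNNReal_coe]
  have e2 : Real.toNNReal (((L * τ : ℝ≥0) : ℝ) - L * τ) = 0 := by simp
  rw [incrementMoment, e1, e2]
  simp_rw [h1]
  rw [h.integral_gridInc_sq_mul_sq hL hL]
  simp [sqCov, sigmaSq]
  ring

end Market

/-! ### The spread estimator and its asymptotic variance -/

section Limits

variable {Ω : Type*} [MeasurableSpace Ω] {μ : Measure Ω} {β H : ℕ → Ω → ℝ} {s e : ℝ}

/-- The spread estimator in terms of the empirical variances on the grid. -/
lemma spreadEstimator_logPrice {Ω : Type*} (S : ℝ) (pStar X : ℝ≥0 → Ω → ℝ) (τ : ℝ≥0) (v : Scheme)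
    (L L' n : ℕ) :
    spreadEstimator (logPrice S pStar X) τ v L L' n = fun ω => 2 / ((L' : ℝ) - L) *
      (L' * gridVar (midGrid pStar τ) (noiseGrid S X τ) v n L ω -
        L * gridVar (midGrid pStar τ) (noiseGrid S X τ) v n L' ω) := by
  ext ω
  rw [spreadEstimator, empVar_logPrice, empVar_logPrice]

lemma spread_eq (s S : ℝ) {L L' : ℕ} (h : L ≠ L') :
    2 / ((L' : ℝ) - L) * (L' * (s * L + 2 * (S ^ 2 / 4)) - L * (s * L' + 2 * (S ^ 2 / 4))) =
      S ^ 2 := by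
  have h1 : (L' : ℝ) - L ≠ 0 := sub_ne_zero.2 (by exact_mod_cast h.symm)
  field_simp
  ring

/-- Linear combinations of two empirical variances are consistent. -/
lemma GridModel.tendstoInMeasure_gridVar_comb (h : GridModel μ β H s e) (v : Scheme) {L L' : ℕ}
    (hL : 1 ≤ L) (hL' : 1 ≤ L') (a b : ℝ) :
    TendstoInMeasure μ (fun n ω => a * gridVar β H v n L ω - b * gridVar β H v n L' ω) atTop
      (fun _ => a * (s * L + 2 * e) - b * (s * L' + 2 * e)) := by
  have := h.isProbabilityMeasure
  have hD : ∀ L n, MemLp (fun ω => gridVar β H v n L ω - (s * L + 2 * e)) 2 μ :=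
    fun L n => (h.memLp_gridVar v n L).sub (memLp_const _)
  have hlim : Tendsto (fun n => ∫ ω, (a * (gridVar β H v n L ω - (s * L + 2 * e)) +
      -b * (gridVar β H v n L' ω - (s * L' + 2 * e))) ^ 2 ∂μ) atTop (𝓝 0) := by
    have hb := ((h.tendsto_integral_gridVar_sub_sq v hL).const_mul (2 * a ^ 2)).add
      ((h.tendsto_integral_gridVar_sub_sq v hL').const_mul (2 * (-b) ^ 2))
    simp only [mul_zero, add_zero] at hb
    refine squeeze_zero (fun n => integral_nonneg fun ω => sq_nonneg _) (fun n => ?_) hb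
    have h1 := integral_add_sq_le ((hD L n).const_mul a) ((hD L' n).const_mul (-b))
    simpa only [mul_pow, integral_const_mul, ← mul_assoc] using h1
  have h0 := tendstoInMeasure_zero_of_integral_sq
    (fun n => ((hD L n).const_mul a).add ((hD L' n).const_mul (-b))) hlim
  rw [tendstoInMeasure_iff_norm] at h0 ⊢
  intro ε hε
  refine (h0 ε hε).congr fun n => ?_
  have h1 : ∀ ω, ((fun ω => a * (gridVar β H v n L ω - (s * L + 2 * e))) +
      fun ω => -b * (gridVar β H v n L' ω - (s * L' + 2 * e))) ω - (0 : Ω → ℝ) ω =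
      a * gridVar β H v n L ω - b * gridVar β H v n L' ω -
        (a * (s * L + 2 * e) - b * (s * L' + 2 * e)) := fun ω => by
    simp only [Pi.add_apply, Pi.zero_apply]
    ring
  simp_rw [h1]

/-- The limit of n·Var is the step times `sigmaSq`, so the square roots in the variance formula
cancel the denominator of the limit correlation and leave the limit covariance. -/
lemma asympVar_eq (σ S : ℝ) (τ : ℝ≥0) (v : Scheme) {L L' : ℕ} (hL : 1 ≤ L) (hL' : 1 ≤ L')
    (h : 0 < sigmaSq σ S τ v L) (h' : 0 < sigmaSq σ S τ v L') (d : ℝ) :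
    asympVar σ S τ v L L' (v.step L * v.step L' * d /
        (√(v.step L * v.step L * (sigmaSq σ S τ v L / v.step L)) *
          √(v.step L' * v.step L' * (sigmaSq σ S τ v L' / v.step L')))) =
      4 / ((L' : ℝ) - L) ^ 2 * ((L' : ℝ) ^ 2 * v.step L * sigmaSq σ S τ v L +
        (L : ℝ) ^ 2 * v.step L' * sigmaSq σ S τ v L' - 2 * L * L' * (v.step L * v.step L' * d)) := by
  have hs : (0 : ℝ) < v.step L := by exact_mod_cast v.step_pos hL
  have hs' : (0 : ℝ) < v.step L' := by exact_mod_cast v.step_pos hL'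
  have e1 : (v.step L * v.step L * (sigmaSq σ S τ v L / v.step L) : ℝ) =
      v.step L * sigmaSq σ S τ v L := by field_simp
  have e2 : (v.step L' * v.step L' * (sigmaSq σ S τ v L' / v.step L') : ℝ) =
      v.step L' * sigmaSq σ S τ v L' := by field_simp
  have hne : √(v.step L : ℝ) ≠ 0 := (Real.sqrt_pos.2 hs).ne'
  have hne' : √(v.step L' : ℝ) ≠ 0 := (Real.sqrt_pos.2 hs').ne'
  have hse : √(sigmaSq σ S τ v L) ≠ 0 := (Real.sqrt_pos.2 h).ne'
  have hse' : √(sigmaSq σ S τ v L') ≠ 0 := (Real.sqrt_pos.2 h').ne'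
  rw [asympVar, e1, e2, Scheme.zeta_eq, Scheme.zeta_eq, Real.sqrt_mul hs.le, Real.sqrt_mul hs.le,
    Real.sqrt_mul hs'.le]
  congr 2
  field_simp

end Limits

end BidAskSpread

/-! ### Main theorem -/

theorem mainTheorem1 {Ω : Type*} [MeasurableSpace Ω] (μ : Measure Ω) [IsProbabilityMeasure μ]
    (pStar X : ℝ≥0 → Ω → ℝ) (σ S : ℝ) (hσ : 0 < σ)
    (hModel : BidAskSpread.MarketModel μ pStar X σ S)
    (τ : ℝ≥0) (hτ : 0 < τ) (v : BidAskSpread.Scheme)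
    (L L' : ℕ) (hL : 1 ≤ L) (hL' : 1 ≤ L') (hLL' : L ≠ L') :
    -- unbiasedness
    (∀ n : ℕ, L < n → L' < n →
      Integrable (BidAskSpread.spreadEstimator (BidAskSpread.logPrice S pStar X) τ v L L' n) μ ∧
      ∫ ω, BidAskSpread.spreadEstimator (BidAskSpread.logPrice S pStar X) τ v L L' n ω ∂μ = S ^ 2) ∧
    -- consistency
    TendstoInMeasure μ
      (fun n => BidAskSpread.spreadEstimator (BidAskSpread.logPrice S pStar X) τ v L L' n)
      atTop (fun _ => S ^ 2) ∧
    -- strong consistency for strictly disjoint increments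
    (v = BidAskSpread.Scheme.disjoint →
      ∀ᵐ ω ∂μ, Tendsto
        (fun n => BidAskSpread.spreadEstimator (BidAskSpread.logPrice S pStar X) τ v L L' n ω)
        atTop (𝓝 (S ^ 2))) ∧
    -- existence of the limit correlation, and asymptotic normality
    ∃ r : ℝ,
      Tendsto (fun n => BidAskSpread.corr μ
          (BidAskSpread.empVar (BidAskSpread.logPrice S pStar X) τ v n L)
          (BidAskSpread.empVar (BidAskSpread.logPrice S pStar X) τ v n L'))
        atTop (𝓝 r) ∧
      0 ≤ BidAskSpread.asympVar σ S τ v L L' r ∧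
      TendstoInDistribution
        (fun (n : ℕ) (ω : Ω) => √(n : ℝ) *
          (BidAskSpread.spreadEstimator (BidAskSpread.logPrice S pStar X) τ v L L' n ω - S ^ 2))
        atTop (id : ℝ → ℝ) (fun _ => μ)
        (gaussianReal 0 (BidAskSpread.asympVar σ S τ v L L' r).toNNReal) ∧
      -- explicit variance in a special case
      (v = BidAskSpread.Scheme.disjoint → ∀ m : ℕ, 2 ≤ m → L' + 1 = m * (L + 1) →
        BidAskSpread.asympVar σ S τ v L L' r =
          BidAskSpread.explicitVar (BidAskSpread.logPrice S pStar X) μ S τ L L') := by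
  have h := hModel.gridModel hσ hτ
  have hLr : (L' : ℝ) - L ≠ 0 := sub_ne_zero.2 (by exact_mod_cast hLL'.symm)
  have hs := BidAskSpread.spread_eq (σ ^ 2 * τ) S hLL'
  have hpos := BidAskSpread.sigmaSq_pos (S := S) hσ hτ v hL
  have hpos' := BidAskSpread.sigmaSq_pos (S := S) hσ hτ v hL'
  have hst : (0 : ℝ) < v.step L := by exact_mod_cast v.step_pos hL
  have hst' : (0 : ℝ) < v.step L' := by exact_mod_cast v.step_pos hL'
  have hc := BidAskSpread.tendsto_gridCov_self σ S τ v hL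
  have hc' := BidAskSpread.tendsto_gridCov_self σ S τ v hL'
  obtain ⟨d, hd⟩ := BidAskSpread.exists_tendsto_gridCov (σ ^ 2 * τ) (S ^ 2 / 4) v hL hL'
  simp_rw [BidAskSpread.spreadEstimator_logPrice, BidAskSpread.empVar_logPrice]
  have hasymp := BidAskSpread.asympVar_eq σ S τ v hL hL' hpos hpos' d
  set c : ℝ := 2 / ((L' : ℝ) - L) with hcdef
  refine ⟨fun n hn hn' => ⟨?_, ?_⟩, ?_, ?_, _,
    h.tendsto_corr_gridVar v hL hL' (by positivity) (by positivity) hc hc' hd, ?_⟩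
  · exact ((((h.memLp_gridVar v n L).const_mul _).sub
      ((h.memLp_gridVar v n L').const_mul _)).const_mul _).integrable (by simp)
  · rw [integral_const_mul, integral_sub (((h.memLp_gridVar v n L).const_mul _).integrable (by simp))
      (((h.memLp_gridVar v n L').const_mul _).integrable (by simp)), integral_const_mul,
      integral_const_mul, h.integral_gridVar v hL hn, h.integral_gridVar v hL' hn', hs]
  · have h1 := h.tendstoInMeasure_gridVar_comb v hL hL' (c * L') (c * L)
    simp only [mul_assoc c, ← mul_sub] at h1
    rwa [hs] at h1
  · rintro rfl
    filter_upwards [h.ae_tendsto_gridVar_disjoint hL, h.ae_tendsto_gridVar_disjoint hL']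
      with ω h1 h2
    rw [← hs]
    exact ((h1.const_mul _).sub (h2.const_mul _)).const_mul _
  · rw [hasymp]
    obtain ⟨hγ0, hclt⟩ := h.tendstoInDistribution_gridErr v hL hL' (c * L') (c * L) hc hc' hd
      (γ := 4 / ((L' : ℝ) - L) ^ 2 * ((L' : ℝ) ^ 2 * v.step L * BidAskSpread.sigmaSq σ S τ v L +
        (L : ℝ) ^ 2 * v.step L' * BidAskSpread.sigmaSq σ S τ v L' -
          2 * L * L' * (v.step L * v.step L' * d))) (by
        rw [hcdef]
        field_simp
        ring)
    refine ⟨hγ0, ?_, ?_⟩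
    · convert hclt using 3 with n ω
      rw [BidAskSpread.gridErr, BidAskSpread.gridErr]
      -- By `hs`, centering the estimator at S² amounts to centering each empirical variance at its
      -- own mean.
      linear_combination √(n : ℝ) * hs
    · rintro rfl m hm hLm
      -- The covariance rate `d`, so far only known to exist, is identified by uniqueness of limits.
      have hdeq := tendsto_nhds_unique hd (BidAskSpread.tendsto_gridCov_disjoint _ _ hL hm hLm)
      have hm' : (m : ℝ) = ((L' : ℝ) + 1) / (L + 1) := by
        rw [eq_div_iff (by positivity)]
        exact_mod_cast hLm.symm
      simp only [BidAskSpread.explicitVar]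
      rw [BidAskSpread.incrementVar_logPrice h hL, BidAskSpread.incrementVar_logPrice h hL',
        BidAskSpread.incrementMoment_logPrice h hL, BidAskSpread.incrementMoment_logPrice h hL',
        hdeq, hm']
      simp only [BidAskSpread.sigmaSq, BidAskSpread.Scheme.step]
      push_cast
      field_simp
      ring
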